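/- Let $m\ge 2$ and $A_m=\{0,1,\dots,m-1\}$ with its natural order, and order $A_m^{\mathbb N}$ lexicographically. Let $t_m\in A_m^{\mathbb N}$ be the generalized Thue–Morse sequence, $t_m^{(i)} = s_2(i) \bmod m$, where $s_2(i)$ is the sum of the binary digits of $i$. Let $\sigma$ be the shift on $A_m^{\mathbb N}$ (erasing the first letter) and let $L_m=\overline{\{\sigma^n(t_m) : n\in\mathbb N\}}$ be the Thue–Morse subshift. Let $SP_{L_m}$ be the set of infinite left special words of $L_m$, i.e. the infinite words $w$ such that for every prefix $v$ of $w$ there are at least two letters $a$ for which $av$ is a factor of $L_m$. Then $L_m$ is a minimal aperiodic subshift, it carries exactly one $\sigma$-invariant Borel probability measure $\mu$, this measure is non-atomic and positive on every cylinder $\{w\in L_m : v \text{ is a prefix of } w\}$, $v$ a factor of $L_m$, and $$\mu(SP_{L_m})=0 .$$ Moreover, $L_m$ yields an interval exchange transformation $T_{L_m}$, as follows. For a word $w$ put $\phi_\mu(w)=\mu(\{u\in L_m : u\le w\})$. For every $x\in[0,1]$, the set $\{u\in L_m:\phi_\mu(u)=x\}$ is either a single word or a pair $w<w'$ of consecutive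 words of $L_m$ (no word of $L_m$ lies strictly between them); let $\phi_\mu^{inv}(x)$ be that single word or, respectively, the greater word $w'$. Then $T_{L_m}(x)=\phi_\mu(\sigma(\phi_\mu^{inv}(x)))$ defines a map $T=T_{L_m}:[0,1)\to[0,1)$ which is an orientation-preserving interval exchange transformation in the following sense. The map $T$ is right-continuous and preserves Lebesgue measure. The set $\mathcal D$ consisting of $0$ and of the points of discontinuity of $T$ is countable, and its closure $\overline{\mathcal D}$ in $[0,1)$ has Lebesgue measure zero. The interval $[0,1)$ is partitioned into the intervals $[x,x')$ with $x\in\overline{\mathcal D}$, $x'\in\overline{\mathcal D}\cup\{1\}$, $[x,x')\cap\overline{\mathcal D}=\{x\}$, and the set of accumulation points of $\overline{\mathcal D}$ from the right in $[0,1)$. Finally, $T$ is a translation on each of these intervals. -/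

import Mathlib

open Set MeasureTheory Topology Filter

/-! ### Words, subshifts and factors -/

/-- The shift map on infinite words: it erases the first letter. -/
def wordShift {A : Type*} (w : ℕ → A) : ℕ → A := fun n => w (n + 1)

/-- The prefix of length `n` of an infinite word. -/
def wordPrefix {A : Type*} (w : ℕ → A) (n : ℕ) : List A := (List.range n).map w

/-- A subshift: a closed shift-invariant set of infinite words. -/
def IsSubshift {A : Type*} [TopologicalSpace A] (L : Set (ℕ → A)) : Prop :=
  IsClosed L ∧ MapsTo wordShift L L

/-- The subshift induced by a word: the closure of its shift orbit. -/
def inducedSubshift {A : Type*} [TopologicalSpace A] (w : ℕ → A) : Set (ℕ → A) :=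
  closure (range fun n : ℕ => wordShift^[n] w)

/-- A minimal subshift: nonempty, without proper nonempty subshift. -/
def IsMinimalSubshift {A : Type*} [TopologicalSpace A] (L : Set (ℕ → A)) : Prop :=
  IsSubshift L ∧ L.Nonempty ∧ ∀ K ⊆ L, IsSubshift K → K.Nonempty → K = L

/-- Aperiodicity: `L` contains no word of the form `vvv...` with `v` finite and nonempty. -/
def IsAperiodic {A : Type*} (L : Set (ℕ → A)) : Prop :=
  ∀ w ∈ L, ∀ p : ℕ, 0 < p → wordShift^[p] w ≠ w

/-- The set of finite factors of the words of `L`. -/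
def factors {A : Type*} (L : Set (ℕ → A)) : Set (List A) :=
  {v | ∃ w ∈ L, ∃ i n : ℕ, v = wordPrefix (wordShift^[i] w) n}

/-- The cylinder of `L` over a finite word `v`: the words of `L` with prefix `v`. -/
def wordCylinder {A : Type*} (L : Set (ℕ → A)) (v : List A) : Set (ℕ → A) :=
  {w | w ∈ L ∧ wordPrefix w v.length = v}

/-- The left letter extensions of `v` that are factors of `L`. -/
def leftExtensions {A : Type*} (L : Set (ℕ → A)) (v : List A) : Set (List A) :=
  {u | u ∈ factors L ∧ ∃ a : A, u = a :: v}

/-- A left special factor: one with at least two distinct left letter extensions. -/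
def IsLeftSpecial {A : Type*} (L : Set (ℕ → A)) (v : List A) : Prop :=
  v ∈ factors L ∧ (leftExtensions L v).Nontrivial

/-- The infinite left special words: all their prefixes are left special factors of `L`. -/
def specialWords {A : Type*} (L : Set (ℕ → A)) : Set (ℕ → A) :=
  {w | ∀ n : ℕ, IsLeftSpecial L (wordPrefix w n)}

/-- Shift-invariant Borel probability measures on `L`, viewed as measures on the space of all
words that are carried by `L`. -/
structure IsInvariantProbOn {A : Type*} [MeasurableSpace A] (L : Set (ℕ → A))
    (μ : Measure (ℕ → A)) : Prop where
  prob : IsProbabilityMeasure μ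
  carried : μ Lᶜ = 0
  invariant : MeasurePreserving wordShift μ μ

/-! ### From an ordered subshift to a map of the unit interval -/

/-- Two words `w < w'` of `L` are consecutive (in the lexicographic order) if no word of `L` lies
strictly between them. -/
def IsConsecutive {A : Type*} [LinearOrder A] (L : Set (ℕ → A)) (w w' : ℕ → A) : Prop :=
  w ∈ L ∧ w' ∈ L ∧ toLex w < toLex w' ∧
    ¬ ∃ u ∈ L, toLex w < toLex u ∧ toLex u < toLex w'

/-- The valuation of a word `w`: the measure of the set of all words of `L` that are
lexicographically at most `w`, that is, of the interval from the smallest word of `L` to `w`. -/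
noncomputable def valuation {A : Type*} [LinearOrder A] [MeasurableSpace A] (L : Set (ℕ → A))
    (μ : Measure (ℕ → A)) (w : ℕ → A) : ℝ :=
  μ.real {u | u ∈ L ∧ toLex u ≤ toLex w}

/-- `w` is the chosen preimage of `x` under the valuation on `L`: either the only preimage, or the
greater one of exactly two preimages, which are consecutive words. -/
def IsValuationInv {A : Type*} [LinearOrder A] [MeasurableSpace A] (L : Set (ℕ → A))
    (μ : Measure (ℕ → A)) (x : ℝ) (w : ℕ → A) : Prop :=
  {u | u ∈ L ∧ valuation L μ u = x} = {w} ∨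
    ∃ v, IsConsecutive L v w ∧ {u | u ∈ L ∧ valuation L μ u = x} = {v, w}

/-- The inverse of the valuation (arbitrary at `x` if there is no chosen preimage of `x`). -/
noncomputable def valuationInv {A : Type*} [Nonempty A] [LinearOrder A] [MeasurableSpace A]
    (L : Set (ℕ → A)) (μ : Measure (ℕ → A)) (x : ℝ) : ℕ → A :=
  Classical.epsilon fun w => IsValuationInv L μ x w

/-- The map `T_L`: inverse valuation, then shift, then valuation. -/
noncomputable def shiftOnInterval {A : Type*} [Nonempty A] [LinearOrder A] [MeasurableSpace A]
    (L : Set (ℕ → A)) (μ : Measure (ℕ → A)) (x : ℝ) : ℝ :=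
  valuation L μ (wordShift (valuationInv L μ x))

/-! ### Interval exchange transformations of `[0, 1)` -/

/-- Lebesgue measure on `[0, 1)`. -/
noncomputable def lebesgueIco : Measure (Ico (0 : ℝ) 1) := Measure.comap Subtype.val volume

/-- The discontinuities of a self-map of `[0, 1)`. The left end `0` of the domain is always
counted, so that the discontinuities cut all of `[0, 1)` into intervals. -/
def discontinuities (T : Ico (0 : ℝ) 1 → Ico (0 : ℝ) 1) : Set (Ico (0 : ℝ) 1) :=
  {x | (x : ℝ) = 0 ∨ ¬ ContinuousAt T x}

/-- The right-open intervals `[x, x')` with `x ∈ E`, `x' ∈ E ∪ {1}` and `[x, x') ∩ E = {x}`. -/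
def gapIntervals (E : Set (Ico (0 : ℝ) 1)) : Set (Set (Ico (0 : ℝ) 1)) :=
  {J | ∃ x ∈ E, ∃ x' : ℝ, (x' = 1 ∨ ∃ z ∈ E, (z : ℝ) = x') ∧
    J = {y | x ≤ y ∧ (y : ℝ) < x'} ∧ J ∩ E = {x}}

/-- The points of `[0, 1)` that are accumulation points of `E` from the right. -/
def rightAccPts (E : Set (Ico (0 : ℝ) 1)) : Set (Ico (0 : ℝ) 1) :=
  {x | AccPt x (𝓟 (E ∩ Ioi x))}

/-- An orientation-preserving, possibly infinite, interval exchange transformation of `[0, 1)`. -/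
structure IsIntervalExchange (T : Ico (0 : ℝ) 1 → Ico (0 : ℝ) 1) : Prop where
  rightContinuous : ∀ x, ContinuousWithinAt T (Ici x) x
  measurePreserving : MeasurePreserving T lebesgueIco lebesgueIco
  countable : (discontinuities T).Countable
  null : lebesgueIco (closure (discontinuities T)) = 0
  /-- `[0, 1)` is partitioned into the right-open intervals and the set of accumulation points
  from the right. -/
  partition : ∀ y,
    (y ∈ rightAccPts (closure (discontinuities T)) ∧
      ¬ ∃ J ∈ gapIntervals (closure (discontinuities T)), y ∈ J) ∨
    (y ∉ rightAccPts (closure (discontinuities T)) ∧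
      ∃! J, J ∈ gapIntervals (closure (discontinuities T)) ∧ y ∈ J)
  translation : ∀ J ∈ gapIntervals (closure (discontinuities T)),
    ∃ c : ℝ, ∀ y ∈ J, (T y : ℝ) = y + c

/-! ### The generalized Thue–Morse subshifts -/

/-- The generalized Thue–Morse sequence over `m` letters: its `i`-th letter is the sum of the
binary digits of `i`, modulo `m`. -/
def thueMorse (m : ℕ) [NeZero m] : ℕ → Fin m := fun i => Fin.ofNat m (Nat.digits 2 i).sum

/-- The Thue–Morse subshift over `m` letters. -/
def thueMorseShift (m : ℕ) [NeZero m] : Set (ℕ → Fin m) := inducedSubshift (thueMorse m)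

/-! ### The lexicographic order on words -/

section Lex

variable {m : ℕ}

/-! Everything rests on `thueMorse_pow_mul_add`: for `r < 2 ^ k` the letter at `2 ^ k * q + r` is
the sum of the letters at `q` and `r`.

Left special words. By `thueMorse_parity` a factor of length six determines the parity of its
position. So when a long block occurs after two different letters, both occurrences begin at even
positions, and the argument can be repeated at half the scale. Longer blocks must thus start at
multiples of higher powers of 2 (`two_pow_dvd_of_left_special`), and an infinite left special word
can only be a translate `a + t` of the sequence `t`. There are at most `m` of these, so a non-atomic
measure ignores them.

Measures. Krylov–Bogoliubov gives an invariant measure. Minimality and aperiodicity make it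
faithful: an atom would be a periodic word, and the words avoiding a null cylinder would form a
proper subshift. For uniqueness, the frequency of a word in an aligned block depends on only two
consecutive letters of `t`. One of the `R` children of every block has the same pair as block 0, so
averaging contracts the oscillation (`exists_bounds_of_averages`).

Interval exchange. The valuation of a faithful measure is continuous, maps onto `[0,1]` and carries
the measure to Lebesgue measure. Near a word whose shift is not left special, the shift has a single
inverse branch, so invariance makes it a translation in valuation coordinates. Hence the interval
map is right-continuous and, off a countable set, a translation on each side of every point.
`isIntervalExchange_of_local` shows that this suffices. -/

theorem toLex_lt_iff {u w : ℕ → Fin m} :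
    toLex u < toLex w ↔ ∃ i, (∀ j < i, u j = w j) ∧ u i < w i := Iff.rfl

theorem exists_first_ne {u w : ℕ → Fin m} (h : u ≠ w) :
    ∃ i, (∀ j < i, u j = w j) ∧ u i ≠ w i := by
  classical
  have h' : ∃ i, u i ≠ w i := Function.ne_iff.1 h
  exact ⟨Nat.find h', fun j hj => not_not.1 (Nat.find_min h' hj), Nat.find_spec h'⟩

theorem toLex_wordShift_lt {u w : ℕ → Fin m} (h : u 0 = w 0) :
    toLex (wordShift u) < toLex (wordShift w) ↔ toLex u < toLex w := by
  constructor
  · rintro ⟨i, h1, h2⟩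
    refine ⟨i + 1, fun j hj => ?_, h2⟩
    rcases j with _ | j
    · exact h
    · exact h1 j (Nat.lt_of_succ_lt_succ hj)
  · rintro ⟨i, h1, h2⟩
    rcases i with _ | i
    · exact absurd h (ne_of_lt h2)
    · exact ⟨i, fun j hj => h1 (j + 1) (Nat.succ_lt_succ hj), h2⟩

theorem toLex_wordShift_le {u w : ℕ → Fin m} (h : u 0 = w 0) :
    toLex (wordShift u) ≤ toLex (wordShift w) ↔ toLex u ≤ toLex w := by
  exact not_lt.symm.trans ((not_congr (toLex_wordShift_lt h.symm)).trans not_lt)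

theorem continuous_wordShift {A : Type*} [TopologicalSpace A] :
    Continuous (wordShift : (ℕ → A) → ℕ → A) :=
  continuous_pi fun n => continuous_apply (n + 1)

theorem wordShift_iterate {A : Type*} (n : ℕ) (w : ℕ → A) (k : ℕ) :
    wordShift^[n] w k = w (k + n) := by
  induction n generalizing k with
  | zero => rfl
  | succ n ih =>
    rw [Function.iterate_succ_apply', wordShift, ih]
    congr 1
    omega

theorem wordShift_mem_cylinder {u w : ℕ → Fin m} {n : ℕ} (h : u ∈ PiNat.cylinder w (n + 1)) :
    wordShift u ∈ PiNat.cylinder (wordShift w) n :=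
  fun i hi => h (i + 1) (Nat.succ_lt_succ hi)

theorem mem_cylinder_of_toLex_le {x u v w : ℕ → Fin m} {n : ℕ} (hu : u ∈ PiNat.cylinder x n)
    (hw : w ∈ PiNat.cylinder x n) (huv : toLex u ≤ toLex v) (hvw : toLex v ≤ toLex w) :
    v ∈ PiNat.cylinder x n := by
  by_cases hvx : v = x
  · rw [hvx]; exact PiNat.self_mem_cylinder x n
  obtain ⟨i, h1, h2⟩ := exists_first_ne hvx
  intro j hj
  by_contra hne
  have hin : i < n := by
    by_contra hni
    exact hne (h1 j (by omega))
  rcases lt_or_gt_of_ne h2 with h3 | h3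
  · refine absurd huv (not_le.2 (toLex_lt_iff.2 ⟨i, fun j hj => ?_, ?_⟩))
    · exact (h1 j hj).trans (hu j (hj.trans hin)).symm
    · rw [hu i hin]; exact h3
  · refine absurd hvw (not_le.2 (toLex_lt_iff.2 ⟨i, fun j hj => ?_, ?_⟩))
    · exact (hw j (hj.trans hin)).trans (h1 j hj).symm
    · rw [hw i hin]; exact h3

theorem isOpen_cylinder_word (w : ℕ → Fin m) (n : ℕ) : IsOpen (PiNat.cylinder w n) :=
  PiNat.isOpen_cylinder (fun _ => Fin m) w n

theorem exists_cylinder_subset {U : Set (ℕ → Fin m)} (hU : IsOpen U) {w : ℕ → Fin m}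
    (hw : w ∈ U) : ∃ n, PiNat.cylinder w n ⊆ U := by
  obtain ⟨_, ⟨x, n, rfl⟩, hx, hs⟩ :=
    (PiNat.isTopologicalBasis_cylinders (fun _ => Fin m)).exists_subset_of_mem_open hw hU
  exact ⟨n, by rwa [PiNat.mem_cylinder_iff_eq.1 hx]⟩

theorem isOpen_lexIio (w : ℕ → Fin m) : IsOpen {u : ℕ → Fin m | toLex u < toLex w} := by
  rw [isOpen_iff_mem_nhds]
  intro u hu
  obtain ⟨i, h1, h2⟩ := toLex_lt_iff.1 hu
  refine mem_of_superset ((isOpen_cylinder_word u (i + 1)).mem_nhds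
    (PiNat.self_mem_cylinder u _)) fun v hv => toLex_lt_iff.2 ⟨i, fun j hj => ?_, ?_⟩
  · exact (hv j (by omega)).trans (h1 j hj)
  · rw [hv i (by omega)]; exact h2

theorem isOpen_lexIoi (w : ℕ → Fin m) : IsOpen {u : ℕ → Fin m | toLex w < toLex u} := by
  rw [isOpen_iff_mem_nhds]
  intro u hu
  obtain ⟨i, h1, h2⟩ := toLex_lt_iff.1 hu
  refine mem_of_superset ((isOpen_cylinder_word u (i + 1)).mem_nhds
    (PiNat.self_mem_cylinder u _)) fun v hv => toLex_lt_iff.2 ⟨i, fun j hj => ?_, ?_⟩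
  · exact (h1 j hj).trans (hv j (by omega)).symm
  · rw [hv i (by omega)]; exact h2

theorem isClosed_lexIic (w : ℕ → Fin m) : IsClosed {u : ℕ → Fin m | toLex u ≤ toLex w} := by
  rw [← isOpen_compl_iff]
  convert isOpen_lexIoi w using 1
  ext u
  exact not_le (a := toLex u) (b := toLex w)

theorem isClosed_lexIci (w : ℕ → Fin m) : IsClosed {u : ℕ → Fin m | toLex w ≤ toLex u} := by
  rw [← isOpen_compl_iff]
  convert isOpen_lexIio w using 1
  ext u
  exact not_le (a := toLex w) (b := toLex u)

theorem IsClosed.exists_lexLeast {K : Set (ℕ → Fin m)} (hK : IsClosed K) (hne : K.Nonempty) :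
    ∃ z ∈ K, ∀ u ∈ K, toLex z ≤ toLex u := by
  -- `Lex` is given the product topology; its lower rays are closed, which is all that the extreme
  -- value theorem for compact sets needs.
  let : TopologicalSpace (Lex (ℕ → Fin m)) := inferInstanceAs (TopologicalSpace (ℕ → Fin m))
  have : ClosedIicTopology (Lex (ℕ → Fin m)) := ⟨fun a => isClosed_lexIic (ofLex a)⟩
  have hc : IsCompact (X := Lex (ℕ → Fin m)) K := hK.isCompact
  obtain ⟨z, hz, hz'⟩ := IsCompact.exists_isLeast hc hne
  exact ⟨z, hz, fun u hu => hz' hu⟩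

theorem IsClosed.exists_lexGreatest {K : Set (ℕ → Fin m)} (hK : IsClosed K) (hne : K.Nonempty) :
    ∃ z ∈ K, ∀ u ∈ K, toLex u ≤ toLex z := by
  let : TopologicalSpace (Lex (ℕ → Fin m)) := inferInstanceAs (TopologicalSpace (ℕ → Fin m))
  have : ClosedIciTopology (Lex (ℕ → Fin m)) := ⟨fun a => isClosed_lexIci (ofLex a)⟩
  have hc : IsCompact (X := Lex (ℕ → Fin m)) K := hK.isCompact
  obtain ⟨z, hz, hz'⟩ := IsCompact.exists_isGreatest hc hne
  exact ⟨z, hz, fun u hu => hz' hu⟩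

end Lex

/-! ### The valuation of a subshift with a faithful invariant measure -/

/-- An invariant probability measure on a subshift without atoms and with full support. -/
structure IsFaithfulOn {m : ℕ} (L : Set (ℕ → Fin m)) (μ : Measure (ℕ → Fin m)) : Prop
    extends IsInvariantProbOn L μ where
  isSubshift : IsSubshift L
  null_singleton : ∀ w, μ {w} = 0
  pos_cylinder : ∀ w ∈ L, ∀ n, 0 < μ (L ∩ PiNat.cylinder w n)

namespace IsFaithfulOn

variable {m : ℕ} {L : Set (ℕ → Fin m)} {μ : Measure (ℕ → Fin m)}

theorem measurableSet (h : IsFaithfulOn L μ) : MeasurableSet L := h.isSubshift.1.measurableSet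

theorem ae_mem (h : IsFaithfulOn L μ) : ∀ᵐ w ∂μ, w ∈ L := h.carried

theorem valuation_sub (h : IsFaithfulOn L μ) {u w : ℕ → Fin m} (huw : toLex u ≤ toLex w) :
    valuation L μ w - valuation L μ u =
      μ.real {v | v ∈ L ∧ toLex u < toLex v ∧ toLex v ≤ toLex w} := by
  have := h.prob
  have hm : MeasurableSet {v | v ∈ L ∧ toLex v ≤ toLex u} :=
    (h.isSubshift.1.inter (isClosed_lexIic u)).measurableSet
  unfold valuation
  have hs : {v | v ∈ L ∧ toLex v ≤ toLex u} ⊆ {v | v ∈ L ∧ toLex v ≤ toLex w} :=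
    fun v hv => ⟨hv.1, hv.2.trans huw⟩
  rw [← measureReal_sdiff hs hm]
  congr 1
  ext v
  simp only [Set.mem_sdiff, mem_ofPred_eq, not_and, not_le]
  exact ⟨fun ⟨⟨a, b⟩, c⟩ => ⟨a, c a, b⟩, fun ⟨a, b, c⟩ => ⟨⟨a, c⟩, fun _ => b⟩⟩

theorem valuation_mono (h : IsFaithfulOn L μ) {u w : ℕ → Fin m} (huw : toLex u ≤ toLex w) :
    valuation L μ u ≤ valuation L μ w := by
  have := h.valuation_sub huw
  have h2 := measureReal_nonneg (μ := μ)
    (s := {v | v ∈ L ∧ toLex u < toLex v ∧ toLex v ≤ toLex w})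
  linarith

theorem valuation_nonneg (w : ℕ → Fin m) : 0 ≤ valuation L μ w := measureReal_nonneg

theorem valuation_le_one (h : IsFaithfulOn L μ) (w : ℕ → Fin m) : valuation L μ w ≤ 1 :=
  have := h.prob
  measureReal_le_one

theorem valuation_eq_of_forall (h : IsFaithfulOn L μ) {u w : ℕ → Fin m}
    (huw : toLex u ≤ toLex w)
    (hn : ∀ v ∈ L, toLex u < toLex v → toLex v ≤ toLex w → v = w) :
    valuation L μ u = valuation L μ w := by
  have h0 : μ.real {v | v ∈ L ∧ toLex u < toLex v ∧ toLex v ≤ toLex w} = 0 := by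
    rw [measureReal_def, measure_mono_null (t := {w}) (fun v hv => hn v hv.1 hv.2.1 hv.2.2)
      (h.null_singleton w), ENNReal.toReal_zero]
  have := h.valuation_sub huw
  linarith

theorem valuation_lt (h : IsFaithfulOn L μ) {u v w : ℕ → Fin m} (hv : v ∈ L)
    (huv : toLex u < toLex v) (hvw : toLex v < toLex w) :
    valuation L μ u < valuation L μ w := by
  have := h.prob
  obtain ⟨n, hn⟩ := exists_cylinder_subset ((isOpen_lexIoi u).inter (isOpen_lexIio w))
    (w := v) ⟨huv, hvw⟩
  have h1 : 0 < μ.real {v | v ∈ L ∧ toLex u < toLex v ∧ toLex v ≤ toLex w} := by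
    refine ENNReal.toReal_pos (ne_of_gt ((h.pos_cylinder v hv n).trans_le
      (measure_mono fun x hx => ?_))) (measure_ne_top _ _)
    exact ⟨hx.1, (hn hx.2).1, (hn hx.2).2.le⟩
  have := h.valuation_sub (huv.trans hvw).le
  linarith

theorem isConsecutive_of_valuation_eq (h : IsFaithfulOn L μ) {u w : ℕ → Fin m} (hu : u ∈ L)
    (hw : w ∈ L) (huw : toLex u < toLex w) (he : valuation L μ u = valuation L μ w) :
    IsConsecutive L u w :=
  ⟨hu, hw, huw, fun ⟨_, hv, h1, h2⟩ => (h.valuation_lt hv h1 h2).ne he⟩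

/-- Only the greatest word of `L` has valuation `1`. -/
theorem toLex_le_of_valuation_eq_one (h : IsFaithfulOn L μ) {u v : ℕ → Fin m} (hv : v ∈ L)
    (hu : valuation L μ u = 1) : toLex v ≤ toLex u := by
  have := h.prob
  by_contra! hlt
  obtain ⟨n, hn⟩ := exists_cylinder_subset (isOpen_lexIoi u) (w := v) hlt
  have h1 : Disjoint {v | v ∈ L ∧ toLex v ≤ toLex u} (L ∩ PiNat.cylinder v n) :=
    Set.disjoint_left.2 fun x hx hx' => absurd (hn hx'.2) (not_lt.2 hx.2)
  have h2 : 0 < μ.real (L ∩ PiNat.cylinder v n) :=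
    ENNReal.toReal_pos (h.pos_cylinder v hv n).ne' (measure_ne_top _ _)
  have h3 := measureReal_union (μ := μ) h1
    (h.measurableSet.inter (isOpen_cylinder_word v n).measurableSet)
  have h4 : μ.real ({v | v ∈ L ∧ toLex v ≤ toLex u} ∪ L ∩ PiNat.cylinder v n) ≤ 1 :=
    measureReal_le_one
  unfold valuation at hu
  linarith

/-! ### Continuity and surjectivity of the valuation -/

theorem exists_cylinder_lt (h : IsFaithfulOn L μ) (w : ℕ → Fin m) {ε : ℝ} (hε : 0 < ε) :
    ∃ n, μ.real (PiNat.cylinder w n) < ε := by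
  have := h.prob
  have h1 : Tendsto (fun n => μ.real (PiNat.cylinder w n)) atTop (𝓝 0) := by
    have h2 := tendsto_measure_iInter_atTop (μ := μ) (s := fun n => PiNat.cylinder w n)
      (fun n => (isOpen_cylinder_word w n).measurableSet.nullMeasurableSet)
      (fun a b hab => PiNat.cylinder_anti w hab) ⟨0, measure_ne_top _ _⟩
    have h3 : ⋂ n, PiNat.cylinder w n = {w} := by
      ext u
      simp only [mem_iInter, mem_singleton_iff]
      refine ⟨fun hu => funext fun i => hu (i + 1) i i.lt_succ_self, ?_⟩
      rintro rfl n
      exact PiNat.self_mem_cylinder u n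
    rw [h3, h.null_singleton w] at h2
    exact (ENNReal.tendsto_toReal ENNReal.zero_ne_top).comp h2
  exact (h1.eventually_lt_const hε).exists

theorem abs_valuation_sub_le (h : IsFaithfulOn L μ) {u w : ℕ → Fin m} {n : ℕ}
    (hu : u ∈ PiNat.cylinder w n) :
    |valuation L μ u - valuation L μ w| ≤ μ.real (PiNat.cylinder w n) := by
  have := h.prob
  have key : ∀ a b : ℕ → Fin m, a ∈ PiNat.cylinder w n → b ∈ PiNat.cylinder w n →
      toLex a ≤ toLex b →
      |valuation L μ b - valuation L μ a| ≤ μ.real (PiNat.cylinder w n) := by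
    intro a b ha hb hab
    rw [h.valuation_sub hab, abs_of_nonneg measureReal_nonneg]
    exact measureReal_mono fun v hv => mem_cylinder_of_toLex_le ha hb hv.2.1.le hv.2.2
  rcases le_total (toLex u) (toLex w) with h1 | h1
  · rw [abs_sub_comm]
    exact key u w hu (PiNat.self_mem_cylinder w n) h1
  · exact key w u (PiNat.self_mem_cylinder w n) hu h1

theorem continuous_valuation (h : IsFaithfulOn L μ) : Continuous (valuation L μ) := by
  rw [continuous_iff_continuousAt]
  intro w
  rw [ContinuousAt, Metric.tendsto_nhds]
  intro ε hε
  obtain ⟨n, hn⟩ := h.exists_cylinder_lt w hε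
  filter_upwards [(isOpen_cylinder_word w n).mem_nhds (PiNat.self_mem_cylinder w n)] with u hu
  exact (h.abs_valuation_sub_le hu).trans_lt hn

theorem nonempty (h : IsFaithfulOn L μ) : L.Nonempty := by
  have := h.prob
  exact h.ae_mem.exists

/-- An intermediate value argument on a totally disconnected set. If `x` were skipped, the greatest
word valued at most `x` and the least word valued at least `x` would have no word of `L` between
them, and then absence of atoms gives them equal valuations. -/
theorem exists_valuation_eq (h : IsFaithfulOn L μ) {x : ℝ} (hx : x ∈ Icc (0 : ℝ) 1) :
    ∃ u ∈ L, valuation L μ u = x := by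
  have := h.prob
  by_contra! hne
  have hA : IsClosed (L ∩ {u | valuation L μ u ≤ x}) :=
    h.isSubshift.1.inter (isClosed_le h.continuous_valuation continuous_const)
  have hB : IsClosed (L ∩ {u | x ≤ valuation L μ u}) :=
    h.isSubshift.1.inter (isClosed_le continuous_const h.continuous_valuation)
  obtain ⟨z, hz, hz'⟩ := h.isSubshift.1.exists_lexLeast h.nonempty
  have hz0 : valuation L μ z = 0 := by
    rw [valuation, measureReal_def, measure_mono_null (t := {z}) _ (h.null_singleton z),
      ENNReal.toReal_zero]
    exact fun v hv => toLex.injective (le_antisymm hv.2 (hz' v hv.1))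
  obtain ⟨y, hy, hy'⟩ := h.isSubshift.1.exists_lexGreatest h.nonempty
  have hy1 : valuation L μ y = 1 := by
    rw [valuation, measureReal_def, (prob_compl_eq_zero_iff (hs := ?_)).1, ENNReal.toReal_one]
    · refine measure_mono_null (fun v hv hvL => hv ⟨hvL, hy' v hvL⟩) h.carried
    · exact (h.isSubshift.1.inter (isClosed_lexIic y)).measurableSet
  obtain ⟨a, ha, ha'⟩ := hA.exists_lexGreatest ⟨z, hz, show valuation L μ z ≤ x from hz0 ▸ hx.1⟩
  obtain ⟨b, hb, hb'⟩ := hB.exists_lexLeast ⟨y, hy, show x ≤ valuation L μ y from hy1 ▸ hx.2⟩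
  have hax : valuation L μ a < x := lt_of_le_of_ne ha.2 (hne a ha.1)
  have hbx : x < valuation L μ b := lt_of_le_of_ne hb.2 (hne b hb.1).symm
  have hab : toLex a ≤ toLex b := by
    by_contra! hlt
    exact absurd (h.valuation_mono hlt.le) (not_le.2 (hax.trans hbx))
  refine (hax.trans hbx).ne (h.valuation_eq_of_forall hab fun v hv h1 h2 => ?_)
  refine toLex.injective (le_antisymm h2 (hb' v ⟨hv, ?_⟩))
  by_contra hlt
  have hvx : valuation L μ v < x := not_le.1 hlt
  exact absurd (ha' v ⟨hv, hvx.le⟩) (not_le.2 h1)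

/-- Fibres of the valuation have at most two words: strictly between the extremes of three lies a
whole cylinder of positive measure. The chosen preimage is therefore just the greatest word of the
fibre. -/
theorem isValuationInv_iff (h : IsFaithfulOn L μ) {x : ℝ} {w : ℕ → Fin m} :
    IsValuationInv L μ x w ↔ w ∈ L ∧ valuation L μ w = x ∧
      ∀ u ∈ L, valuation L μ u = x → toLex u ≤ toLex w := by
  constructor
  · rintro (h1 | ⟨v, hc, h1⟩)
    · have hw : w ∈ {u | u ∈ L ∧ valuation L μ u = x} := by rw [h1]; rfl
      refine ⟨hw.1, hw.2, fun u hu hux => ?_⟩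
      have : u ∈ ({w} : Set (ℕ → Fin m)) := by rw [← h1]; exact ⟨hu, hux⟩
      rw [this]
    · have hw : w ∈ {u | u ∈ L ∧ valuation L μ u = x} := by rw [h1]; simp
      refine ⟨hw.1, hw.2, fun u hu hux => ?_⟩
      have : u ∈ ({v, w} : Set (ℕ → Fin m)) := by rw [← h1]; exact ⟨hu, hux⟩
      rcases this with rfl | rfl
      · exact hc.2.2.1.le
      · exact le_rfl
  · rintro ⟨hw, hx, hg⟩
    by_cases hs : ∃ v ∈ L, valuation L μ v = x ∧ v ≠ w
    · obtain ⟨v, hv, hvx, hne⟩ := hs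
      have hvw : toLex v < toLex w :=
        lt_of_le_of_ne (hg v hv hvx) fun he => hne (toLex.injective he)
      refine Or.inr ⟨v, h.isConsecutive_of_valuation_eq hv hw hvw (hvx.trans hx.symm), ?_⟩
      refine Subset.antisymm (fun u ⟨hu, hux⟩ => ?_) ?_
      · by_contra hn
        simp only [mem_insert_iff, mem_singleton_iff, not_or] at hn
        have huw : toLex u < toLex w :=
          lt_of_le_of_ne (hg u hu hux) fun he => hn.2 (toLex.injective he)
        rcases lt_trichotomy (toLex u) (toLex v) with h1 | h1 | h1
        · exact (h.valuation_lt hv h1 hvw).ne (hux.trans hx.symm)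
        · exact hn.1 (toLex.injective h1)
        · exact (h.valuation_lt hu h1 huw).ne (hvx.trans hx.symm)
      · rintro u (rfl | rfl)
        · exact ⟨hv, hvx⟩
        · exact ⟨hw, hx⟩
    · push Not at hs
      refine Or.inl (Subset.antisymm (fun u hu => hs u hu.1 hu.2) ?_)
      rintro u rfl
      exact ⟨hw, hx⟩

theorem existsUnique_isValuationInv (h : IsFaithfulOn L μ) {x : ℝ} (hx : x ∈ Icc (0 : ℝ) 1) :
    ∃! w, IsValuationInv L μ x w := by
  have hc : IsClosed (L ∩ {u | valuation L μ u = x}) :=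
    h.isSubshift.1.inter (isClosed_eq h.continuous_valuation continuous_const)
  obtain ⟨w, hw, hw'⟩ := hc.exists_lexGreatest (h.exists_valuation_eq hx)
  refine ⟨w, h.isValuationInv_iff.2 ⟨hw.1, hw.2, fun u hu hux => hw' u ⟨hu, hux⟩⟩, fun v hv => ?_⟩
  obtain ⟨h1, h2, h3⟩ := h.isValuationInv_iff.1 hv
  exact toLex.injective (le_antisymm (hw' v ⟨h1, h2⟩) (h3 w hw.1 hw.2))

theorem exists_least_valuation_eq (h : IsFaithfulOn L μ) {x : ℝ} (hx : x ∈ Icc (0 : ℝ) 1) :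
    ∃ w ∈ L, valuation L μ w = x ∧ ∀ u ∈ L, valuation L μ u = x → toLex w ≤ toLex u := by
  have hc : IsClosed (L ∩ {u | valuation L μ u = x}) :=
    h.isSubshift.1.inter (isClosed_eq h.continuous_valuation continuous_const)
  obtain ⟨w, hw, hw'⟩ := hc.exists_lexLeast (h.exists_valuation_eq hx)
  exact ⟨w, hw.1, hw.2, fun u hu hux => hw' u ⟨hu, hux⟩⟩

/-! ### The inverse valuation -/

variable [NeZero m]

theorem valuationInv_spec (h : IsFaithfulOn L μ) {x : ℝ} (hx : x ∈ Icc (0 : ℝ) 1) :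
    valuationInv L μ x ∈ L ∧ valuation L μ (valuationInv L μ x) = x ∧
      ∀ u ∈ L, valuation L μ u = x → toLex u ≤ toLex (valuationInv L μ x) :=
  h.isValuationInv_iff.1 (Classical.epsilon_spec (h.existsUnique_isValuationInv hx).exists)

/-- Choosing the greater word makes `valuationInv` the upper adjoint of the valuation on `L`; right
continuity of the interval map comes from this. -/
theorem valuation_le_iff (h : IsFaithfulOn L μ) {x : ℝ} (hx : x ∈ Icc (0 : ℝ) 1)
    {u : ℕ → Fin m} (hu : u ∈ L) :
    valuation L μ u ≤ x ↔ toLex u ≤ toLex (valuationInv L μ x) := by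
  obtain ⟨_, h2, h3⟩ := h.valuationInv_spec hx
  constructor
  · intro hux
    rcases hux.lt_or_eq with h4 | h4
    · by_contra! hlt
      exact absurd (h.valuation_mono hlt.le) (not_le.2 (h2.symm ▸ h4))
    · exact h3 u hu h4
  · intro hle
    exact (h.valuation_mono hle).trans h2.le

end IsFaithfulOn

/-! ### Interval exchange transformations from local translations -/

section IntervalExchange

/-- If the left ends differed, the larger one would be a second point of `E` in the other interval.
A smaller right end in `E` would likewise lie inside the longer interval. -/
theorem gapIntervals_unique {E : Set (Ico (0 : ℝ) 1)} {J J' : Set (Ico (0 : ℝ) 1)}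
    {y : Ico (0 : ℝ) 1} (hJ : J ∈ gapIntervals E) (hJ' : J' ∈ gapIntervals E) (hy : y ∈ J)
    (hy' : y ∈ J') : J = J' := by
  obtain ⟨x, hx, z, hz, hJeq, hJE⟩ := hJ
  obtain ⟨x', hx', z', hz', hJeq', hJE'⟩ := hJ'
  have hxJ : x ∈ J := (hJE.symm ▸ mem_singleton x : x ∈ J ∩ E).1
  have hxJ' : x' ∈ J' := (hJE'.symm ▸ mem_singleton x' : x' ∈ J' ∩ E).1
  rw [hJeq] at hy hxJ
  rw [hJeq'] at hy' hxJ'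
  have hxx : x = x' := by
    rcases lt_trichotomy x x' with h | h | h
    · have : x' ∈ J ∩ E := ⟨by
        rw [hJeq]; exact ⟨h.le, lt_of_le_of_lt (Subtype.coe_le_coe.2 hy'.1) hy.2⟩, hx'⟩
      rw [hJE] at this
      exact this.symm
    · exact h
    · have : x ∈ J' ∩ E := ⟨by
        rw [hJeq']; exact ⟨h.le, lt_of_le_of_lt (Subtype.coe_le_coe.2 hy.1) hy'.2⟩, hx⟩
      rw [hJE'] at this
      exact this
  subst hxx
  have key : ∀ {a b : ℝ} {J : Set (Ico (0 : ℝ) 1)}, (a = 1 ∨ ∃ e ∈ E, (e : ℝ) = a) →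
      (b = 1 ∨ ∃ e ∈ E, (e : ℝ) = b) → J = {y | x ≤ y ∧ (y : ℝ) < b} → J ∩ E = {x} →
      (x : ℝ) < a → b ≤ a := by
    intro a b J ha hb hJ hJE hxa
    by_contra! hlt
    rcases ha with rfl | ⟨e, he, rfl⟩
    · rcases hb with rfl | ⟨e, he, rfl⟩
      · exact lt_irrefl _ hlt
      · exact absurd e.2.2 (not_lt.2 hlt.le)
    · have : e ∈ J ∩ E := ⟨by rw [hJ]; exact ⟨(Subtype.coe_lt_coe.1 hxa).le, hlt⟩, he⟩
      rw [hJE] at this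
      rw [mem_singleton_iff.1 this] at hxa
      exact lt_irrefl _ hxa
  have hzz : z = z' := le_antisymm (key hz' hz hJeq hJE hxJ'.2) (key hz hz' hJeq' hJE' hxJ.2)
  rw [hJeq, hJeq', hzz]

/-- Although `[0,1)` is not compact, its initial segments are; this yields the nearest points of `E`
on either side of a point. -/
theorem isCompact_Iic_Ico (y : Ico (0 : ℝ) 1) : IsCompact (Iic y) := by
  rw [Subtype.isCompact_iff]
  convert isCompact_Icc (a := (0 : ℝ)) (b := (y : ℝ)) using 1
  ext r
  constructor
  · rintro ⟨z, hz, rfl⟩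
    exact ⟨z.2.1, hz⟩
  · intro hr
    exact ⟨⟨r, hr.1, hr.2.trans_lt y.2.2⟩, hr.2, rfl⟩

theorem exists_gapInterval_of_notMem_rightAccPts {E : Set (Ico (0 : ℝ) 1)} (hE : IsClosed E)
    {x₀ : Ico (0 : ℝ) 1} (h0 : (x₀ : ℝ) = 0) (h0E : x₀ ∈ E) {y : Ico (0 : ℝ) 1}
    (hy : y ∉ rightAccPts E) : ∃ J ∈ gapIntervals E, y ∈ J := by
  obtain ⟨x, ⟨hxy, hxE⟩, hx⟩ := ((isCompact_Iic_Ico y).inter_right hE).exists_isGreatest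
    ⟨x₀, Subtype.coe_le_coe.1 (h0.le.trans y.2.1), h0E⟩
  -- Only `y` could be a missing limit point, and it is excluded as an accumulation point from the
  -- right; so there is a least point of `E` beyond `y`, if any.
  have hA : IsClosed (E ∩ Ioi y) := by
    refine isClosed_of_closure_subset fun z hz => ⟨hE.closure_subset_iff.2 inter_subset_left hz, ?_⟩
    have hyz : y ≤ z := closure_minimal (t := Ici y)
      (fun a ha => (show y < a from ha.2).le) isClosed_Ici hz
    refine lt_of_le_of_ne hyz ?_
    rintro rfl
    refine hy (accPt_principal_iff_clusterPt.2 ?_)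
    rw [sdiff_singleton_eq_self fun h => lt_irrefl y h.2]
    exact mem_closure_iff_clusterPt.1 hz
  obtain ⟨x', hx', hyx', hgap⟩ : ∃ x' : ℝ, (x' = 1 ∨ ∃ z ∈ E, (z : ℝ) = x') ∧ (y : ℝ) < x' ∧
      ∀ e ∈ E, y < e → x' ≤ e := by
    by_cases hne : (E ∩ Ioi y).Nonempty
    · obtain ⟨a, ha⟩ := hne
      obtain ⟨z, hz, hz'⟩ := ((isCompact_Iic_Ico a).inter_right hA).exists_isLeast
        ⟨a, mem_Iic.2 le_rfl, ha⟩
      refine ⟨z, Or.inr ⟨z, hz.2.1, rfl⟩, hz.2.2, fun e he hye => ?_⟩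
      rcases le_total e a with h | h
      · exact hz' ⟨h, he, hye⟩
      · exact (hz' ⟨mem_Iic.2 le_rfl, ha⟩).trans h
    · exact ⟨1, Or.inl rfl, y.2.2, fun e he hye => absurd ⟨e, he, hye⟩ hne⟩
  refine ⟨{z | x ≤ z ∧ (z : ℝ) < x'}, ⟨x, hxE, x', hx', rfl, ?_⟩, hxy, hyx'⟩
  refine Subset.antisymm (fun e ⟨⟨h1, h2⟩, he⟩ => ?_) ?_
  · refine le_antisymm (hx ⟨?_, he⟩) h1
    by_contra hlt
    exact absurd (hgap e he (not_le.1 hlt)) (not_le.2 h2)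
  · rintro _ rfl
    exact ⟨⟨le_rfl, lt_of_le_of_lt (Subtype.coe_le_coe.2 hxy) hyx'⟩, hxE⟩

theorem notMem_gapInterval_of_mem_rightAccPts {E : Set (Ico (0 : ℝ) 1)} (hE : IsClosed E)
    {y : Ico (0 : ℝ) 1} (hy : y ∈ rightAccPts E) : ¬ ∃ J ∈ gapIntervals E, y ∈ J := by
  rintro ⟨J, ⟨x, hxE, x', -, hJ, hJE⟩, hyJ⟩
  have hyE : y ∈ E := by
    have h1 : y ∈ closure (E ∩ Ioi y) :=
      mem_closure_iff_clusterPt.2 (AccPt.clusterPt hy)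
    exact hE.closure_subset_iff.2 inter_subset_left h1
  have hyx : y = x := by
    have : y ∈ J ∩ E := ⟨hyJ, hyE⟩
    rw [hJE] at this
    exact this
  rw [hJ] at hyJ
  have h2 : ∀ᶠ z : Ico (0 : ℝ) 1 in 𝓝 y, (z : ℝ) < x' :=
    continuous_subtype_val.continuousAt.eventually_lt_const hyJ.2
  obtain ⟨z, ⟨hzy, hzE, hyz⟩, hz⟩ := ((accPt_iff_frequently.1 hy).and_eventually h2).exists
  have : z ∈ J ∩ E := ⟨by rw [hJ]; exact ⟨hyJ.1.trans (le_of_lt hyz), hz⟩, hzE⟩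
  rw [hJE] at this
  exact hzy (this.trans hyx.symm)

theorem gapIntervals_partition {E : Set (Ico (0 : ℝ) 1)} (hE : IsClosed E)
    {x₀ : Ico (0 : ℝ) 1} (h0 : (x₀ : ℝ) = 0) (h0E : x₀ ∈ E) (y : Ico (0 : ℝ) 1) :
    (y ∈ rightAccPts E ∧ ¬ ∃ J ∈ gapIntervals E, y ∈ J) ∨
      (y ∉ rightAccPts E ∧ ∃! J, J ∈ gapIntervals E ∧ y ∈ J) := by
  by_cases hy : y ∈ rightAccPts E
  · exact Or.inl ⟨hy, notMem_gapInterval_of_mem_rightAccPts hE hy⟩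
  · obtain ⟨J, hJ, hyJ⟩ := exists_gapInterval_of_notMem_rightAccPts hE h0 h0E hy
    exact Or.inr ⟨hy, J, ⟨hJ, hyJ⟩, fun J' hJ' => gapIntervals_unique hJ'.1 hJ hJ'.2 hyJ⟩

/-! ### Maps that are translations on each side of most points -/

variable {T : Ico (0 : ℝ) 1 → Ico (0 : ℝ) 1} {F : ℝ → ℝ}

theorem continuousAt_Ico_iff (hTF : ∀ x, (T x : ℝ) = F x) (x : Ico (0 : ℝ) 1) :
    ContinuousAt T x ↔ ContinuousWithinAt F (Ico 0 1) x := by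
  rw [Topology.IsInducing.subtypeVal.continuousAt_iff,
    continuousWithinAt_iff_continuousAt_domRestrict F x.2]
  exact iff_of_eq (congrArg (ContinuousAt · x) (funext hTF))

/-- The preimage of an open set is its interior together with some discontinuities. -/
theorem measurable_of_countable_discontinuities (h : (discontinuities T).Countable) :
    Measurable T := by
  refine measurable_of_isOpen fun V hV => ?_
  have h1 : (T ⁻¹' V \ interior (T ⁻¹' V)).Countable := by
    refine h.mono fun x hx => Or.inr fun hc => hx.2 ?_
    exact mem_interior_iff_mem_nhds.2 (hc.preimage_mem_nhds (hV.mem_nhds hx.1))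
  rw [← union_sdiff_cancel (interior_subset (s := T ⁻¹' V))]
  exact isOpen_interior.measurableSet.union h1.measurableSet

theorem HasDerivAt.zero_of_eventually_eq {f : ℝ → ℝ} {x : ℝ} (h : ∀ᶠ y in 𝓝 x, f y = f x) :
    HasDerivAt f 0 x :=
  (hasDerivAt_const x (f x)).congr_of_eventuallyEq h

/-- A continuous function with vanishing derivative off a countable set is constant. -/
theorem eq_of_hasDerivAt_zero_off_countable {f : ℝ → ℝ} {a b : ℝ} (hab : a ≤ b) {S : Set ℝ}
    (hS : S.Countable) (hc : ContinuousOn f (Icc a b))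
    (hd : ∀ x ∈ Ioo a b \ S, HasDerivAt f 0 x) : f b = f a := by
  have := integral_eq_of_hasDerivAt_off_countable_of_le f (fun _ => 0) hab hS hc hd
    intervalIntegrable_const
  simp only [intervalIntegral.integral_zero] at this
  linarith

/-- The constants `c` and `d` may differ, so `x` itself may be a discontinuity, but then it is an
isolated one. -/
theorem eventually_notMem_discontinuities (hTF : ∀ x, (T x : ℝ) = F x) {x : Ico (0 : ℝ) 1}
    (hx : (x : ℝ) ≠ 0) {c d : ℝ} (hr : ∀ᶠ y in 𝓝[>] (x : ℝ), F y - y = c)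
    (hl : ∀ᶠ y in 𝓝[<] (x : ℝ), F y - y = d) :
    ∀ᶠ y in 𝓝[≠] x, y ∉ discontinuities T := by
  have hcont : ∀ {y e : ℝ}, (∀ᶠ z in 𝓝 y, F z - z = e) → ContinuousAt F y := by
    intro y e h
    have h1 : F =ᶠ[𝓝 y] fun z => e + z := h.mono fun z hz => by linarith
    exact (continuousAt_const.add continuousAt_id).congr h1.symm
  have hr' : ∀ᶠ y in 𝓝[>] (x : ℝ), ContinuousAt F y := by
    filter_upwards [eventually_eventually_nhdsWithin.2 hr, self_mem_nhdsWithin] with y hy hxy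
    rw [isOpen_Ioi.nhdsWithin_eq hxy] at hy
    exact hcont hy
  have hl' : ∀ᶠ y in 𝓝[<] (x : ℝ), ContinuousAt F y := by
    filter_upwards [eventually_eventually_nhdsWithin.2 hl, self_mem_nhdsWithin] with y hy hxy
    rw [isOpen_Iio.nhdsWithin_eq hxy] at hy
    exact hcont hy
  have hne : ∀ᶠ y in 𝓝[≠] (x : ℝ), ContinuousAt F y ∧ y ≠ 0 := by
    refine Eventually.and ?_ (nhdsWithin_le_nhds (isOpen_ne.mem_nhds hx))
    rw [← Iio_union_Ioi, nhdsWithin_union]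
    exact eventually_sup.2 ⟨hl', hr'⟩
  rw [eventually_nhdsWithin_iff] at hne ⊢
  filter_upwards [continuous_subtype_val.continuousAt.eventually hne] with y hy hyx
  obtain ⟨h1, h2⟩ := hy fun he => hyx (Subtype.ext he)
  rintro (h3 | h3)
  · exact h2 h3
  · exact h3 ((continuousAt_Ico_iff hTF y).2 h1.continuousWithinAt)

theorem countable_preimage_coe {S : Set ℝ} (hS : S.Countable) :
    {x : Ico (0 : ℝ) 1 | (x : ℝ) ∈ S}.Countable :=
  hS.preimage Subtype.val_injective

theorem countable_closure_discontinuities (hTF : ∀ x, (T x : ℝ) = F x) {S : Set ℝ}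
    (hS : S.Countable)
    (hloc : ∀ x ∈ Ioo (0 : ℝ) 1, x ∉ S → ∃ c d : ℝ, (∀ᶠ y in 𝓝[>] x, F y - y = c) ∧
      ∀ᶠ y in 𝓝[<] x, F y - y = d) :
    (closure (discontinuities T)).Countable := by
  set S' : Set (Ico (0 : ℝ) 1) := {x | (x : ℝ) ∈ insert 0 S} with hS'
  have hS'c : S'.Countable := countable_preimage_coe (hS.insert 0)
  have hiso : ∀ x ∉ S', ∀ᶠ y in 𝓝[≠] x, y ∉ discontinuities T := by
    intro x hx
    simp only [hS', mem_ofPred_eq, mem_insert_iff, not_or] at hx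
    obtain ⟨c, d, hc, hd⟩ := hloc x ⟨lt_of_le_of_ne x.2.1 (Ne.symm hx.1), x.2.2⟩ hx.2
    exact eventually_notMem_discontinuities hTF hx.1 hc hd
  -- Outside `S'` the discontinuities are isolated, and a subset of a line has only countably many
  -- points isolated from the right.
  have hD : (discontinuities T \ S').Countable := by
    refine (countable_setOfPred_isolated_right_within (s := discontinuities T \ S')).mono ?_
    refine fun x hx => ⟨hx, empty_mem_iff_bot.1 ?_⟩
    have h1 : 𝓝[(discontinuities T \ S') ∩ Ioi x] x ≤ 𝓝[≠] x :=
      nhdsWithin_mono x fun y hy => ne_of_gt hy.2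
    filter_upwards [h1 (hiso x hx.2), self_mem_nhdsWithin] with y hy hy'
    exact hy hy'.1.1
  refine (hD.union hS'c).mono fun x hx => ?_
  by_cases hxS : x ∈ S'
  · exact Or.inr hxS
  -- A closure point outside `S'` has no other discontinuity near it, hence is one itself: taking
  -- the closure adds only points of `S'`.
  · refine Or.inl ⟨?_, hxS⟩
    by_contra hxD
    have h1 := eventually_nhdsWithin_iff.1 (hiso x hxS)
    obtain ⟨y, hy, hy'⟩ := mem_closure_iff_frequently.1 hx |>.and_eventually h1 |>.exists
    refine hy' ?_ hy
    rintro rfl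
    exact hxD hy

/-- Countability of the closure gives nullity and measurability, the latter being fed to `hmp`. On a
gap interval `F z - z` is continuous, and off `S` continuity forces both one-sided constants to be
its value, so it has zero derivative off a countable set and is constant. -/
theorem isIntervalExchange_of_local (hTF : ∀ x, (T x : ℝ) = F x)
    (hrc : ∀ x ∈ Ico (0 : ℝ) 1, ContinuousWithinAt F (Ici x) x) {S : Set ℝ} (hS : S.Countable)
    (hloc : ∀ x ∈ Ioo (0 : ℝ) 1, x ∉ S → ∃ c d : ℝ, (∀ᶠ y in 𝓝[>] x, F y - y = c) ∧
      ∀ᶠ y in 𝓝[<] x, F y - y = d)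
    (hmp : Measurable T → MeasurePreserving T lebesgueIco lebesgueIco) :
    IsIntervalExchange T := by
  have hcl := countable_closure_discontinuities hTF hS hloc
  have hco : (discontinuities T).Countable := hcl.mono subset_closure
  have h0 : (⟨0, by norm_num, by norm_num⟩ : Ico (0 : ℝ) 1) ∈ discontinuities T := Or.inl rfl
  refine ⟨fun x => ?_, hmp (measurable_of_countable_discontinuities hco), hco, ?_,
    gapIntervals_partition isClosed_closure rfl (subset_closure h0), ?_⟩
  · rw [Topology.IsInducing.subtypeVal.continuousWithinAt_iff]
    have h1 : ContinuousWithinAt (F ∘ Subtype.val) (Ici x) x :=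
      (hrc x x.2).comp continuous_subtype_val.continuousWithinAt fun y hy => hy
    exact h1.congr (fun y _ => hTF y) (hTF x)
  · rw [lebesgueIco, (MeasurableEmbedding.subtype_coe measurableSet_Ico).comap_apply]
    exact (hcl.image _).measure_zero volume
  · rintro J ⟨x, hx, x', -, hJ, hJE⟩
    refine ⟨T x - x, fun y hy => ?_⟩
    have hJy : ∀ z : Ico (0 : ℝ) 1, x < z → z ≤ y → ContinuousAt F z := by
      intro z hxz hzy
      by_contra hn
      have hzE : z ∈ closure (discontinuities T) := by
        refine subset_closure (Or.inr fun hc => hn ?_)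
        have hz0 : (0 : ℝ) < z := lt_of_le_of_lt x.2.1 hxz
        exact ((continuousAt_Ico_iff hTF z).1 hc).continuousAt (Ico_mem_nhds hz0 z.2.2)
      have : z ∈ J ∩ closure (discontinuities T) := by
        refine ⟨?_, hzE⟩
        rw [hJ] at hy ⊢
        exact ⟨hxz.le, lt_of_le_of_lt (Subtype.coe_le_coe.2 hzy) hy.2⟩
      rw [hJE] at this
      exact hxz.ne' this
    have hxy : x ≤ y := by rw [hJ] at hy; exact hy.1
    have hcont : ∀ z ∈ Ioc (x : ℝ) y, ContinuousAt F z := fun z hz =>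
      hJy ⟨z, x.2.1.trans hz.1.le, hz.2.trans_lt y.2.2⟩ hz.1 hz.2
    have key : (F y - y : ℝ) = F x - x := by
      refine eq_of_hasDerivAt_zero_off_countable (f := fun z => F z - z)
        (Subtype.coe_le_coe.2 hxy) hS ?_ ?_
      · refine ContinuousOn.sub (fun z hz => ?_) continuousOn_id
        rcases hz.1.eq_or_lt with h | h
        -- The left end may be a discontinuity of `T`; right continuity is enough there.
        · rw [← h]
          exact (hrc x x.2).mono fun z hz => hz.1
        · exact (hcont z ⟨h, hz.2⟩).continuousWithinAt
      · rintro z ⟨hz, hzS⟩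
        have hzI : z ∈ Ioo (0 : ℝ) 1 := ⟨x.2.1.trans_lt hz.1, hz.2.trans y.2.2⟩
        obtain ⟨c, d, hc, hd⟩ := hloc z hzI hzS
        have hcz : ContinuousAt (fun z => F z - z) z :=
          (hcont z ⟨hz.1, hz.2.le⟩).sub continuousAt_id
        have h1 : F z - z = c := tendsto_nhds_unique
          (hcz.tendsto.mono_left nhdsWithin_le_nhds)
          (tendsto_const_nhds.congr' (hc.mono fun _ h => h.symm) : Tendsto _ (𝓝[>] z) _)
        have h2 : F z - z = d := tendsto_nhds_unique
          (hcz.tendsto.mono_left nhdsWithin_le_nhds)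
          (tendsto_const_nhds.congr' (hd.mono fun _ h => h.symm) : Tendsto _ (𝓝[<] z) _)
        refine HasDerivAt.zero_of_eventually_eq (f := fun z => F z - z) ?_
        rw [← h1] at hc
        rw [← h2] at hd
        have h3 : ∀ᶠ y in 𝓝[≠] z, F y - y = F z - z := by
          rw [← Iio_union_Ioi, nhdsWithin_union]
          exact eventually_sup.2 ⟨hd, hc⟩
        rw [eventually_nhdsWithin_iff] at h3
        filter_upwards [h3] with w hw
        by_cases hwz : w = z
        · rw [hwz]
        · exact hw hwz
    rw [hTF, hTF]
    linarith

end IntervalExchange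

/-! ### The interval map of a subshift -/

theorem tendsto_of_forall_cylinder {m : ℕ} {α : Type*} {l : Filter α} {f : α → ℕ → Fin m}
    {w : ℕ → Fin m} (h : ∀ n, ∀ᶠ y in l, f y ∈ PiNat.cylinder w n) : Tendsto f l (𝓝 w) := by
  refine tendsto_nhds.2 fun U hU hw => ?_
  obtain ⟨n, hn⟩ := exists_cylinder_subset hU hw
  exact (h n).mono fun y hy => hn hy

theorem wordPrefix_eq_iff {A : Type*} {u w : ℕ → A} {n : ℕ} :
    wordPrefix u n = wordPrefix w n ↔ ∀ i < n, u i = w i := by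
  simp [wordPrefix, List.map_inj_left]

theorem wordPrefix_succ {A : Type*} (w : ℕ → A) (n : ℕ) :
    wordPrefix w (n + 1) = w 0 :: wordPrefix (wordShift w) n := by
  simp [wordPrefix, List.range_succ_eq_map, wordShift, Function.comp_def]

theorem countable_preimage_wordShift {m : ℕ} {S : Set (ℕ → Fin m)} (hS : S.Countable) :
    (wordShift ⁻¹' S).Countable := by
  have hinj : Function.Injective fun w : ℕ → Fin m => (w 0, wordShift w) := by
    intro u w h
    have h' := Prod.mk.inj h
    funext n
    rcases n with _ | n
    · exact h'.1
    · exact congrFun h'.2 n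
  have h1 : ((univ : Set (Fin m)) ×ˢ S).Countable := countable_univ.prod hS
  exact (h1.preimage hinj).mono fun w hw => mk_mem_prod (mem_univ _) hw

/-- A word whose shift is not left special is locally determined by its shift. -/
theorem exists_cylinder_forall_eq {m : ℕ} {L : Set (ℕ → Fin m)} {w : ℕ → Fin m} (hw : w ∈ L)
    (hL : MapsTo wordShift L L) (hns : wordShift w ∉ specialWords L) :
    ∃ n, ∀ v ∈ L, wordShift v ∈ PiNat.cylinder (wordShift w) n → v 0 = w 0 := by
  simp only [specialWords, mem_ofPred_eq, not_forall] at hns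
  obtain ⟨n, hn⟩ := hns
  refine ⟨n, fun v hv hvn => ?_⟩
  have hf : wordPrefix (wordShift w) n ∈ factors L := ⟨_, hL hw, 0, n, rfl⟩
  have hs : ¬ (leftExtensions L (wordPrefix (wordShift w) n)).Nontrivial := fun h => hn ⟨hf, h⟩
  rw [not_nontrivial_iff] at hs
  have h1 : w 0 :: wordPrefix (wordShift w) n ∈
      leftExtensions L (wordPrefix (wordShift w) n) :=
    ⟨⟨w, hw, 0, n + 1, (wordPrefix_succ w n).symm⟩, _, rfl⟩
  have h2 : v 0 :: wordPrefix (wordShift w) n ∈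
      leftExtensions L (wordPrefix (wordShift w) n) := by
    refine ⟨⟨v, hv, 0, n + 1, ?_⟩, _, rfl⟩
    rw [← wordPrefix_eq_iff.2 hvn]
    exact (wordPrefix_succ v n).symm
  exact (List.cons.inj (hs h2 h1)).1

namespace IsFaithfulOn

variable {m : ℕ} {L : Set (ℕ → Fin m)} {μ : Measure (ℕ → Fin m)}

/-- By `hn` every preimage in `L` of the lexicographic interval between the shifted words starts
with the letter `w 0`. So that preimage is, almost everywhere, the interval from `u` to `v`, and
invariance equates the measures. -/
theorem valuation_wordShift_sub (h : IsFaithfulOn L μ) {w : ℕ → Fin m} {n : ℕ}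
    (hn : ∀ v ∈ L, wordShift v ∈ PiNat.cylinder (wordShift w) n → v 0 = w 0)
    {u v : ℕ → Fin m} (hu : u ∈ PiNat.cylinder w (n + 1)) (hv : v ∈ PiNat.cylinder w (n + 1))
    (huv : toLex u ≤ toLex v) :
    valuation L μ (wordShift v) - valuation L μ (wordShift u) =
      valuation L μ v - valuation L μ u := by
  have hu0 : u 0 = w 0 := hu 0 n.succ_pos
  have hv0 : v 0 = w 0 := hv 0 n.succ_pos
  have hm : MeasurableSet {x | x ∈ L ∧ toLex (wordShift u) < toLex x ∧
      toLex x ≤ toLex (wordShift v)} :=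
    h.measurableSet.inter ((isOpen_lexIoi _).measurableSet.inter (isClosed_lexIic _).measurableSet)
  rw [h.valuation_sub huv, h.valuation_sub ((toLex_wordShift_le (hu0.trans hv0.symm)).2 huv),
    ← h.invariant.measureReal_preimage hm.nullMeasurableSet]
  refine measureReal_congr ?_
  filter_upwards [h.ae_mem] with x hx
  refine propext ⟨fun ⟨_, h1, h2⟩ => ?_, fun ⟨_, h1, h2⟩ => ?_⟩
  · have hx0 : x 0 = w 0 := hn x hx (mem_cylinder_of_toLex_le (wordShift_mem_cylinder hu)
      (wordShift_mem_cylinder hv) h1.le h2)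
    exact ⟨hx, (toLex_wordShift_lt (hu0.trans hx0.symm)).1 h1,
      (toLex_wordShift_le (hx0.trans hv0.symm)).1 h2⟩
  · have hx0 : x 0 = w 0 := mem_cylinder_of_toLex_le hu hv h1.le h2 0 n.succ_pos
    exact ⟨h.isSubshift.2 hx, (toLex_wordShift_lt (hu0.trans hx0.symm)).2 h1,
      (toLex_wordShift_le (hx0.trans hv0.symm)).2 h2⟩

theorem eventually_valuation_wordShift_sub (h : IsFaithfulOn L μ) {w : ℕ → Fin m} (hw : w ∈ L)
    (hns : wordShift w ∉ specialWords L) :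
    ∀ᶠ v in 𝓝 w, valuation L μ (wordShift v) - valuation L μ v =
      valuation L μ (wordShift w) - valuation L μ w := by
  obtain ⟨n, hn⟩ := exists_cylinder_forall_eq hw h.isSubshift.2 hns
  filter_upwards [(isOpen_cylinder_word w (n + 1)).mem_nhds (PiNat.self_mem_cylinder w _)]
    with v hv
  rcases le_total (toLex v) (toLex w) with hle | hle
  · linarith [h.valuation_wordShift_sub hn hv (PiNat.self_mem_cylinder w _) hle]
  · linarith [h.valuation_wordShift_sub hn (PiNat.self_mem_cylinder w _) hv hle]

/-! ### One-sided limits, the interval map and Lebesgue measure -/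

variable [NeZero m]

theorem tendsto_valuationInv_right (h : IsFaithfulOn L μ) {x : ℝ} (hx : x ∈ Ico (0 : ℝ) 1) :
    Tendsto (valuationInv L μ) (𝓝[≥] x) (𝓝 (valuationInv L μ x)) := by
  have hx' : x ∈ Icc (0 : ℝ) 1 := ⟨hx.1, hx.2.le⟩
  obtain ⟨hwL, hwx, hwg⟩ := h.valuationInv_spec hx'
  set w := valuationInv L μ x
  refine tendsto_of_forall_cylinder fun n => ?_
  have hy1 : ∀ᶠ y in 𝓝[≥] x, y ∈ Ico x 1 := Ico_mem_nhdsGE hx.2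
  have hge : ∀ y ∈ Ico x 1, valuationInv L μ y ∈ L ∧ toLex w ≤ toLex (valuationInv L μ y) :=
    fun y hy => ⟨(h.valuationInv_spec ⟨hx.1.trans hy.1, hy.2.le⟩).1,
      (h.valuation_le_iff ⟨hx.1.trans hy.1, hy.2.le⟩ hwL).1 (hwx.trans_le hy.1)⟩
  have hZ : IsClosed (L ∩ ({u | toLex w ≤ toLex u} ∩ (PiNat.cylinder w n)ᶜ)) :=
    h.isSubshift.1.inter ((isClosed_lexIci w).inter (isOpen_cylinder_word w n).isClosed_compl)
  by_cases hne : (L ∩ ({u | toLex w ≤ toLex u} ∩ (PiNat.cylinder w n)ᶜ)).Nonempty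
  -- The first word of `L` above `w` that leaves the cylinder. Its valuation exceeds `x` because `w`
  -- is greatest in its fibre, and until `y` reaches that value the inverse stays in the cylinder.
  · obtain ⟨z, ⟨hzL, hwz, hzn⟩, hz⟩ := hZ.exists_lexLeast hne
    have hxz : x < valuation L μ z := by
      by_contra! hle
      have he := toLex.injective (le_antisymm hwz ((h.valuation_le_iff hx' hzL).1 hle))
      exact hzn (he ▸ PiNat.self_mem_cylinder w n)
    filter_upwards [hy1, nhdsWithin_le_nhds (Iio_mem_nhds hxz)] with y hy hyz
    obtain ⟨h1, h2⟩ := hge y hy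
    by_contra hyn
    exact absurd ((h.valuation_le_iff ⟨hx.1.trans hy.1, hy.2.le⟩ hzL).2 (hz _ ⟨h1, h2, hyn⟩))
      (not_le.2 hyz)
  · filter_upwards [hy1] with y hy
    obtain ⟨h1, h2⟩ := hge y hy
    by_contra hyn
    exact hne ⟨_, h1, h2, hyn⟩

/-- From the left the inverse tends to the least word of the fibre, not the chosen greatest one;
this is what makes jumps of the interval map possible. -/
theorem tendsto_valuationInv_left (h : IsFaithfulOn L μ) {x : ℝ} (hx : x ∈ Ioo (0 : ℝ) 1)
    {w : ℕ → Fin m} (hwx : valuation L μ w = x)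
    (hwl : ∀ u ∈ L, valuation L μ u = x → toLex w ≤ toLex u) :
    Tendsto (valuationInv L μ) (𝓝[<] x) (𝓝 w) := by
  refine tendsto_of_forall_cylinder fun n => ?_
  have hy1 : ∀ᶠ y in 𝓝[<] x, y ∈ Ico 0 x := Ico_mem_nhdsLT hx.1
  have hle : ∀ y ∈ Ico 0 x, valuationInv L μ y ∈ L ∧ valuation L μ (valuationInv L μ y) = y ∧
      toLex (valuationInv L μ y) ≤ toLex w := by
    intro y hy
    obtain ⟨h1, h2, -⟩ := h.valuationInv_spec (x := y) ⟨hy.1, (hy.2.trans hx.2).le⟩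
    refine ⟨h1, h2, ?_⟩
    by_contra! hlt
    have := h.valuation_mono hlt.le
    rw [hwx, h2] at this
    exact absurd hy.2 (not_lt.2 this)
  have hZ : IsClosed (L ∩ ({u | toLex u ≤ toLex w} ∩ (PiNat.cylinder w n)ᶜ)) :=
    h.isSubshift.1.inter ((isClosed_lexIic w).inter (isOpen_cylinder_word w n).isClosed_compl)
  by_cases hne : (L ∩ ({u | toLex u ≤ toLex w} ∩ (PiNat.cylinder w n)ᶜ)).Nonempty
  · obtain ⟨z, ⟨hzL, hzw, hzn⟩, hz⟩ := hZ.exists_lexGreatest hne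
    have hxz : valuation L μ z < x := by
      refine lt_of_le_of_ne ((h.valuation_mono hzw).trans hwx.le) fun he => ?_
      have he := toLex.injective (le_antisymm hzw (hwl z hzL he))
      exact hzn (he ▸ PiNat.self_mem_cylinder w n)
    filter_upwards [hy1, nhdsWithin_le_nhds (Ioi_mem_nhds hxz)] with y hy hyz
    obtain ⟨h1, h2, h3⟩ := hle y hy
    by_contra hyn
    have := h.valuation_mono (hz _ ⟨h1, h3, hyn⟩)
    rw [h2] at this
    exact absurd hyz (not_lt.2 this)
  · filter_upwards [hy1] with y hy
    obtain ⟨h1, _, h3⟩ := hle y hy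
    by_contra hyn
    exact hne ⟨_, h1, h3, hyn⟩

theorem shiftOnInterval_continuousWithinAt (h : IsFaithfulOn L μ) {x : ℝ}
    (hx : x ∈ Ico (0 : ℝ) 1) : ContinuousWithinAt (shiftOnInterval L μ) (Ici x) x :=
  ((h.continuous_valuation.comp continuous_wordShift).tendsto _).comp
    (h.tendsto_valuationInv_right hx)

theorem shiftOnInterval_locally_translation (h : IsFaithfulOn L μ) {x : ℝ}
    (hx : x ∈ Ioo (0 : ℝ) 1)
    (hxS : x ∉ valuation L μ '' (wordShift ⁻¹' specialWords L)) :
    ∃ c d : ℝ, (∀ᶠ y in 𝓝[>] x, shiftOnInterval L μ y - y = c) ∧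
      ∀ᶠ y in 𝓝[<] x, shiftOnInterval L μ y - y = d := by
  have hx' : x ∈ Icc (0 : ℝ) 1 := ⟨hx.1.le, hx.2.le⟩
  have hns : ∀ w, valuation L μ w = x → wordShift w ∉ specialWords L :=
    fun w hw hs => hxS ⟨w, hs, hw⟩
  obtain ⟨h1, h2, -⟩ := h.valuationInv_spec hx'
  obtain ⟨w, hw, hwx, hwl⟩ := h.exists_least_valuation_eq hx'
  refine ⟨valuation L μ (wordShift (valuationInv L μ x)) - valuation L μ (valuationInv L μ x),
    valuation L μ (wordShift w) - valuation L μ w, ?_, ?_⟩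
  · have h3 := (h.tendsto_valuationInv_right ⟨hx.1.le, hx.2⟩).mono_left
      (nhdsWithin_mono x Ioi_subset_Ici_self)
    filter_upwards [h3 (h.eventually_valuation_wordShift_sub h1 (hns _ h2)),
      Ioo_mem_nhdsGT hx.2] with y hy hxy
    have h4 := (h.valuationInv_spec (x := y) ⟨(hx.1.trans hxy.1).le, hxy.2.le⟩).2.1
    have h5 : valuation L μ (wordShift (valuationInv L μ y)) -
      valuation L μ (valuationInv L μ y) = _ := hy
    rw [h4] at h5
    exact h5
  · filter_upwards [h.tendsto_valuationInv_left hx hwx hwl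
      (h.eventually_valuation_wordShift_sub hw (hns _ hwx)), Ioo_mem_nhdsLT hx.1] with y hy hxy
    have h4 := (h.valuationInv_spec (x := y) ⟨hxy.1.le, (hxy.2.trans hx.2).le⟩).2.1
    have h5 : valuation L μ (wordShift (valuationInv L μ y)) -
      valuation L μ (valuationInv L μ y) = _ := hy
    rw [h4] at h5
    exact h5

theorem shiftOnInterval_mem_Ico (h : IsFaithfulOn L μ) {x : ℝ} (hx : x ∈ Ico (0 : ℝ) 1) :
    shiftOnInterval L μ x ∈ Ico (0 : ℝ) 1 := by
  -- Were the value 1, the shifted word would be greatest in `L`. For `y` slightly above `x` the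
  -- inverse has the same first letter, so it could not exceed the inverse at `x`, forcing `y ≤ x`.
  refine ⟨valuation_nonneg _, lt_of_le_of_ne (h.valuation_le_one _) fun he => ?_⟩
  have hev : ∀ᶠ y in 𝓝[>] x, valuationInv L μ y ∈ PiNat.cylinder (valuationInv L μ x) 1 :=
    (h.tendsto_valuationInv_right hx).mono_left (nhdsWithin_mono x Ioi_subset_Ici_self)
      ((isOpen_cylinder_word _ 1).mem_nhds (PiNat.self_mem_cylinder _ 1))
  obtain ⟨y, hy, hxy⟩ := (hev.and (Ioo_mem_nhdsGT hx.2)).exists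
  have hyI : y ∈ Icc (0 : ℝ) 1 := ⟨hx.1.trans hxy.1.le, hxy.2.le⟩
  obtain ⟨h1, h2, -⟩ := h.valuationInv_spec ⟨hx.1, hx.2.le⟩
  obtain ⟨h3, h4, -⟩ := h.valuationInv_spec hyI
  have h5 := h.toLex_le_of_valuation_eq_one (h.isSubshift.2 h3) he
  have h6 := h.valuation_mono ((toLex_wordShift_le (hy 0 one_pos)).1 h5)
  rw [h2, h4] at h6
  exact absurd hxy.1 (not_lt.2 h6)

/-- Almost every word is the chosen preimage of its valuation. -/
theorem ae_valuationInv_valuation (h : IsFaithfulOn L μ) :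
    ∀ᵐ w ∂μ, valuationInv L μ (valuation L μ w) = w := by
  have hmem : ∀ w, valuation L μ w ∈ Icc (0 : ℝ) 1 := fun w =>
    ⟨valuation_nonneg w, h.valuation_le_one w⟩
  -- A word below its chosen preimage is the lower end of a gap of `L`, hence the greatest word of
  -- `L` in some cylinder. Each length has finitely many cylinders, so such words are countable.
  set N : ℕ → Set (ℕ → Fin m) := fun n =>
    {w | w ∈ L ∧ ∀ v ∈ L, v ∈ PiNat.cylinder w n → toLex v ≤ toLex w}
  have hN : ∀ n, (N n).Countable := by
    intro n
    have hinj : InjOn (fun (w : ℕ → Fin m) (i : Fin n) => w i) (N n) := by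
      intro u hu w hw huw
      have h1 : ∀ i < n, u i = w i := fun i hi => congrFun huw ⟨i, hi⟩
      exact toLex.injective (le_antisymm (hw.2 u hu.1 h1)
        (hu.2 w hw.1 fun i hi => (h1 i hi).symm))
    exact ((toFinite _).of_finite_image hinj).countable
  have hN0 : ∀ᵐ w ∂μ, w ∉ ⋃ n, N n := by
    rw [← compl_compl (⋃ n, N n)]
    refine (measure_eq_zero_iff_ae_notMem (μ := μ)).1 ?_ |>.mono fun w hw => not_not.2 hw
    rw [← biUnion_of_singleton (⋃ n, N n)]
    exact (measure_biUnion_null_iff (countable_iUnion hN)).2 fun w _ => h.null_singleton w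
  filter_upwards [hN0, h.ae_mem] with w hw hwL
  by_contra hne
  obtain ⟨h1, h2, h3⟩ := h.valuationInv_spec (hmem w)
  have hlt : toLex w < toLex (valuationInv L μ (valuation L μ w)) :=
    lt_of_le_of_ne (h3 w hwL rfl) fun he => hne (toLex.injective he).symm
  obtain ⟨n, hn⟩ := exists_cylinder_subset (isOpen_lexIio _) (w := w) hlt
  refine hw (mem_iUnion.2 ⟨n, hwL, fun v hv hvn => ?_⟩)
  by_contra! hwv
  exact (h.valuation_lt hv hwv (hn hvn)).ne h2.symm

/-- On rays: the words valued at most `c` are those up to `valuationInv L μ c`, and their measure is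
the valuation of that word, namely `c`. -/
theorem map_valuation (h : IsFaithfulOn L μ) :
    μ.map (valuation L μ) = volume.restrict (Ico 0 1) := by
  have := h.prob
  have hm := h.continuous_valuation.measurable
  have : IsFiniteMeasure (volume.restrict (Ico (0 : ℝ) 1)) := ⟨by simp⟩
  have := Measure.isProbabilityMeasure_map hm.aemeasurable (μ := μ)
  refine Measure.ext_of_Iic _ _ fun c => ?_
  rw [Measure.map_apply hm measurableSet_Iic, Measure.restrict_apply measurableSet_Iic]
  rcases lt_or_ge c 0 with hc | hc
  · have h1 : valuation L μ ⁻¹' Iic c = ∅ := by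
      ext w
      simpa using hc.trans_le (valuation_nonneg w)
    have h2 : Iic c ∩ Ico 0 1 = ∅ := by
      ext y
      simp only [mem_inter_iff, mem_Iic, mem_Ico, mem_empty_iff_false, iff_false]
      intro hy
      linarith [hy.1, hy.2.1]
    rw [h1, h2, measure_empty, measure_empty]
  rcases lt_or_ge c 1 with hc1 | hc1
  · have h2 : Iic c ∩ Ico 0 1 = Icc 0 c := by
      ext y
      simp only [mem_inter_iff, mem_Iic, mem_Ico, mem_Icc]
      exact ⟨fun hy => ⟨hy.2.1, hy.1⟩, fun hy => ⟨hy.2, hy.1, hy.2.trans_lt hc1⟩⟩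
    have h1 : valuation L μ ⁻¹' Iic c =ᵐ[μ]
        {u | u ∈ L ∧ toLex u ≤ toLex (valuationInv L μ c)} := by
      filter_upwards [h.ae_mem] with u hu
      exact propext ((h.valuation_le_iff ⟨hc, hc1.le⟩ hu).trans
        ⟨fun h' => ⟨hu, h'⟩, fun h' => h'.2⟩)
    rw [h2, Real.volume_Icc, sub_zero, measure_congr h1, ← ofReal_measureReal]
    exact congrArg _ (h.valuationInv_spec ⟨hc, hc1.le⟩).2.1
  · have h1 : valuation L μ ⁻¹' Iic c = univ :=
      eq_univ_of_forall fun w => (h.valuation_le_one w).trans hc1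
    have h2 : Iic c ∩ Ico 0 1 = Ico 0 1 :=
      inter_eq_right.2 fun y hy => hy.2.le.trans hc1
    rw [h1, h2, measure_univ, Real.volume_Ico, sub_zero, ENNReal.ofReal_one]

theorem lebesgueIco_apply (h : IsFaithfulOn L μ) {B : Set (Ico (0 : ℝ) 1)}
    (hB : MeasurableSet B) :
    lebesgueIco B = μ (valuation L μ ⁻¹' (Subtype.val '' B)) := by
  have hB' : MeasurableSet (Subtype.val '' B) := measurableSet_Ico.subtype_image hB
  rw [lebesgueIco, (MeasurableEmbedding.subtype_coe measurableSet_Ico).comap_apply,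
    ← Measure.map_apply h.continuous_valuation.measurable hB', h.map_valuation,
    Measure.restrict_apply hB', inter_eq_left.2]
  rintro _ ⟨x, -, rfl⟩
  exact x.2

theorem ae_valuation_mem_Ico (h : IsFaithfulOn L μ) : ∀ᵐ w ∂μ, valuation L μ w ∈ Ico (0 : ℝ) 1 := by
  refine ae_of_ae_map h.continuous_valuation.aemeasurable ?_
  rw [h.map_valuation]
  exact ae_restrict_mem measurableSet_Ico

theorem measurePreserving_of_eq_shiftOnInterval (h : IsFaithfulOn L μ)
    {T : Ico (0 : ℝ) 1 → Ico (0 : ℝ) 1} (hT : ∀ x, (T x : ℝ) = shiftOnInterval L μ x)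
    (hTm : Measurable T) : MeasurePreserving T lebesgueIco lebesgueIco := by
  refine ⟨hTm, Measure.ext fun B hB => ?_⟩
  have hB' : MeasurableSet (valuation L μ ⁻¹' (Subtype.val '' B)) :=
    h.continuous_valuation.measurable (measurableSet_Ico.subtype_image hB)
  rw [Measure.map_apply hTm hB, h.lebesgueIco_apply hB, h.lebesgueIco_apply (hTm hB),
    ← h.invariant.measure_preimage hB'.nullMeasurableSet]
  refine measure_congr ?_
  -- Almost everywhere the valuation intertwines the shift with `T`, so invariance transfers to
  -- Lebesgue measure.
  filter_upwards [h.ae_valuationInv_valuation, h.ae_valuation_mem_Ico] with w hw hw1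
  have key : (T ⟨valuation L μ w, hw1⟩ : ℝ) = valuation L μ (wordShift w) := by
    rw [hT, shiftOnInterval, hw]
  refine propext ⟨?_, ?_⟩
  · rintro ⟨x, hx, hxw⟩
    have : x = ⟨valuation L μ w, hw1⟩ := Subtype.ext hxw
    exact ⟨T x, hx, by rw [this, key]⟩
  · rintro ⟨x, hx, hxw⟩
    refine ⟨⟨valuation L μ w, hw1⟩, ?_, rfl⟩
    have : T ⟨valuation L μ w, hw1⟩ = x := Subtype.ext (key.trans hxw.symm)
    rw [mem_preimage, this]
    exact hx

/-- The interval map of a subshift with countably many infinite left special words is an interval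
exchange transformation. -/
theorem exists_isIntervalExchange (h : IsFaithfulOn L μ) (hS : (specialWords L).Countable) :
    ∃ T : Ico (0 : ℝ) 1 → Ico (0 : ℝ) 1,
      (∀ x, (T x : ℝ) = shiftOnInterval L μ x) ∧ IsIntervalExchange T := by
  refine ⟨fun x => ⟨shiftOnInterval L μ x, h.shiftOnInterval_mem_Ico x.2⟩, fun x => rfl, ?_⟩
  exact isIntervalExchange_of_local (F := shiftOnInterval L μ) (fun x => rfl)
    (fun x hx => h.shiftOnInterval_continuousWithinAt hx)
    ((countable_preimage_wordShift hS).image _)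
    (fun x hx hxS => h.shiftOnInterval_locally_translation hx hxS)
    (h.measurePreserving_of_eq_shiftOnInterval fun x => rfl)

end IsFaithfulOn

/-! ### Invariant measures -/

section Invariant

/-- **Krylov–Bogoliubov**: a continuous self-map of a compact space has an invariant probability
measure. -/
theorem exists_measurePreserving_of_continuous {X : Type*} [TopologicalSpace X] [CompactSpace X]
    [T2Space X] [MeasurableSpace X] [BorelSpace X] [HasOuterApproxClosed X] [Nonempty X]
    {f : X → X} (hf : Continuous f) :
    ∃ μ : Measure X, IsProbabilityMeasure μ ∧ MeasurePreserving f μ μ := by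
  obtain ⟨x⟩ := ‹Nonempty X›
  set ν : ℕ → Measure X := fun N =>
    ((N + 1 : ℕ) : ENNReal)⁻¹ • ∑ n ∈ Finset.range (N + 1), Measure.dirac (f^[n] x) with hν
  have hνp : ∀ N, IsProbabilityMeasure (ν N) := by
    intro N
    refine ⟨?_⟩
    simp only [hν, Measure.smul_apply, Measure.coe_finsetSum, Finset.sum_apply, measure_univ,
      Finset.sum_const, Finset.card_range, nsmul_eq_mul, mul_one, smul_eq_mul]
    exact ENNReal.inv_mul_cancel (by simp) (ENNReal.natCast_ne_top _)
  have hint : ∀ N (g : BoundedContinuousFunction X ℝ),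
      ∫ y, g y ∂(ν N) = ((N + 1 : ℕ) : ℝ)⁻¹ * ∑ n ∈ Finset.range (N + 1), g (f^[n] x) := by
    intro N g
    rw [hν, integral_smul_measure, integral_finsetSum_measure fun i _ => g.integrable _]
    simp only [ENNReal.toReal_inv, ENNReal.toReal_natCast, smul_eq_mul]
    congr 1
    exact Finset.sum_congr rfl fun n _ => integral_dirac' _ _ g.continuous.stronglyMeasurable
  set P : ℕ → ProbabilityMeasure X := fun N => ⟨ν N, hνp N⟩
  -- Probability measures on a compact space form a compact space, so the orbit averages converge
  -- along an ultrafilter; being free, it still kills the telescoping error `2 * ‖g‖ / (N + 1)`.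
  obtain ⟨μ, -, hμ⟩ := isCompact_univ.ultrafilter_le_nhds ((hyperfilter ℕ).map P)
    (by simp)
  have hμ' : Tendsto P (hyperfilter ℕ) (𝓝 μ) := hμ
  rw [ProbabilityMeasure.tendsto_iff_forall_integral_tendsto] at hμ'
  refine ⟨μ, inferInstance, hf.measurable, ?_⟩
  have := Measure.isProbabilityMeasure_map hf.measurable.aemeasurable (μ := (μ : Measure X))
  refine ext_of_forall_integral_eq_of_IsFiniteMeasure fun g => ?_
  rw [integral_map hf.measurable.aemeasurable g.continuous.aestronglyMeasurable]
  have h1 := (hμ' (g.compContinuous ⟨f, hf⟩)).sub (hμ' g)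
  refine sub_eq_zero.1 (tendsto_nhds_unique h1 ?_)
  refine squeeze_zero_norm (a := fun N : ℕ => 2 * ‖g‖ * ((N + 1 : ℕ) : ℝ)⁻¹) (fun N => ?_) ?_
  · change ‖∫ y, (g.compContinuous ⟨f, hf⟩) y ∂(ν N) - ∫ y, g y ∂(ν N)‖ ≤ _
    rw [hint, hint, ← mul_sub, ← Finset.sum_sub_distrib]
    have h2 : ∀ n, (g.compContinuous ⟨f, hf⟩) (f^[n] x) - g (f^[n] x) =
        g (f^[n + 1] x) - g (f^[n] x) := by
      intro n
      rw [Function.iterate_succ_apply']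
      rfl
    rw [Finset.sum_congr rfl fun n _ => h2 n, Finset.sum_range_sub fun n => g (f^[n] x), norm_mul,
      norm_inv, Real.norm_natCast, mul_comm]
    gcongr
    calc ‖g (f^[N + 1] x) - g (f^[0] x)‖ ≤ ‖g (f^[N + 1] x)‖ + ‖g (f^[0] x)‖ := norm_sub_le _ _
      _ ≤ ‖g‖ + ‖g‖ := add_le_add (g.norm_coe_le_norm _) (g.norm_coe_le_norm _)
      _ = 2 * ‖g‖ := (two_mul _).symm
  · have h3 : Tendsto (fun N : ℕ => 2 * ‖g‖ * ((N + 1 : ℕ) : ℝ)⁻¹) atTop (𝓝 (2 * ‖g‖ * 0)) :=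
      ((tendsto_inv_atTop_zero.comp tendsto_natCast_atTop_atTop).comp
        (tendsto_add_atTop_nat 1)).const_mul _
    rw [mul_zero] at h3
    exact h3.mono_left Nat.hyperfilter_le_atTop

variable {m : ℕ} {L : Set (ℕ → Fin m)} {μ : Measure (ℕ → Fin m)}

theorem exists_isInvariantProbOn (hL : IsSubshift L) (hne : L.Nonempty) :
    ∃ μ, IsInvariantProbOn L μ := by
  have : Nonempty L := hne.to_subtype
  have : CompactSpace L := isCompact_iff_compactSpace.1 hL.1.isCompact
  have hf : Continuous (hL.2.restrict wordShift L L) :=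
    (continuous_wordShift.comp continuous_subtype_val).subtype_mk _
  obtain ⟨μ, hμ, hμf⟩ := exists_measurePreserving_of_continuous hf
  refine ⟨μ.map Subtype.val, Measure.isProbabilityMeasure_map measurable_subtype_coe.aemeasurable,
    ?_, continuous_wordShift.measurable, ?_⟩
  · rw [Measure.map_apply measurable_subtype_coe hL.1.measurableSet.compl]
    convert measure_empty (μ := μ)
    ext x
    simp
  · rw [Measure.map_map continuous_wordShift.measurable measurable_subtype_coe]
    conv_rhs => rw [← hμf.map_eq]
    rw [Measure.map_map measurable_subtype_coe hμf.measurable]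
    rfl

/-- Poincaré recurrence would return an atom to itself, against aperiodicity. If a cylinder were
null, almost every word would never visit it; such words form a nonempty subshift, so by minimality
all of `L`, including `w`. -/
theorem IsMinimalSubshift.isFaithfulOn (hL : IsMinimalSubshift L) (hap : IsAperiodic L)
    (hμ : IsInvariantProbOn L μ) : IsFaithfulOn L μ where
  toIsInvariantProbOn := hμ
  isSubshift := hL.1
  null_singleton w := by
    have := hμ.prob
    by_contra hne
    obtain ⟨x, rfl, k, hk, hx⟩ := hμ.invariant.conservative.exists_mem_iterate_mem
      (measurableSet_singleton w).nullMeasurableSet hne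
    by_cases hxL : x ∈ L
    · exact hap x hxL k (Nat.pos_of_ne_zero hk) hx
    · exact hne (measure_mono_null (singleton_subset_iff.2 hxL) hμ.carried)
  pos_cylinder w hw n := by
    have := hμ.prob
    refine pos_iff_ne_zero.2 fun h0 => ?_
    have hcyl : μ (PiNat.cylinder w n) = 0 := by
      refine measure_mono_null (t := (L ∩ PiNat.cylinder w n) ∪ Lᶜ) (fun v hv => ?_)
        (measure_union_null h0 hμ.carried)
      by_cases hvL : v ∈ L
      · exact Or.inl ⟨hvL, hv⟩
      · exact Or.inr hvL
    have hk : ∀ k : ℕ, ∀ᵐ v ∂μ, wordShift^[k] v ∉ PiNat.cylinder w n := by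
      intro k
      refine (measure_eq_zero_iff_ae_notMem (s := wordShift^[k] ⁻¹' PiNat.cylinder w n)).1 ?_
      rw [(hμ.invariant.iterate k).measure_preimage
        (isOpen_cylinder_word w n).measurableSet.nullMeasurableSet, hcyl]
    have hLae : ∀ᵐ v ∂μ, v ∈ L := hμ.carried
    set K := L ∩ ⋂ k : ℕ, (wordShift^[k] ⁻¹' PiNat.cylinder w n)ᶜ with hK
    have hKsub : IsSubshift K := by
      refine ⟨hL.1.1.inter (isClosed_iInter fun k => ((isOpen_cylinder_word w n).preimage
        (continuous_wordShift.iterate k)).isClosed_compl), fun v hv => ⟨hL.1.2 hv.1, ?_⟩⟩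
      exact mem_iInter.2 fun k => mem_iInter.1 hv.2 (k + 1)
    have hKne : K.Nonempty := by
      obtain ⟨v, hv, hvL⟩ := ((ae_all_iff.2 hk).and hLae).exists
      exact ⟨v, hvL, mem_iInter.2 hv⟩
    have hKL := hL.2.2 K inter_subset_left hKsub hKne
    rw [← hKL] at hw
    exact mem_iInter.1 hw.2 0 (PiNat.self_mem_cylinder w n)

theorem measure_ext_of_cylinder {μ ν : Measure (ℕ → Fin m)} [IsProbabilityMeasure μ]
    [IsProbabilityMeasure ν]
    (h : ∀ w n, μ (PiNat.cylinder w n) = ν (PiNat.cylinder w n)) : μ = ν := by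
  refine ext_of_generate_finite
    {s | ∃ (x : ℕ → Fin m) (n : ℕ), s = PiNat.cylinder x n} ?_ ?_ ?_ (by simp)
  · rw [← (PiNat.isTopologicalBasis_cylinders fun _ => Fin m).borel_eq_generateFrom]
    exact BorelSpace.measurable_eq
  · rintro _ ⟨x, a, rfl⟩ _ ⟨y, b, rfl⟩ ⟨z, hzx, hzy⟩
    refine ⟨z, max a b, ?_⟩
    rw [← PiNat.mem_cylinder_iff_eq.1 hzx, ← PiNat.mem_cylinder_iff_eq.1 hzy]
    ext v
    simp only [mem_inter_iff, PiNat.mem_cylinder_iff, lt_max_iff]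
    exact ⟨fun ⟨h1, h2⟩ i hi => hi.elim (h1 i) (h2 i),
      fun h1 => ⟨fun i hi => h1 i (Or.inl hi), fun i hi => h1 i (Or.inr hi)⟩⟩
  · rintro _ ⟨x, n, rfl⟩
    exact h x n

/-! ### Minimality and aperiodicity of induced subshifts -/

theorem isSubshift_inducedSubshift {A : Type*} [TopologicalSpace A] (w : ℕ → A) :
    IsSubshift (inducedSubshift w) := by
  refine ⟨isClosed_closure, MapsTo.closure ?_ continuous_wordShift⟩
  rintro _ ⟨n, rfl⟩
  exact ⟨n + 1, Function.iterate_succ_apply' _ _ _⟩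

theorem exists_iterate_mem_cylinder {t w : ℕ → Fin m} (hw : w ∈ inducedSubshift t) (n : ℕ) :
    ∃ p, ∀ i < n, w i = t (i + p) := by
  obtain ⟨_, hu, p, rfl⟩ := mem_closure_iff.1 hw _ (isOpen_cylinder_word w n)
    (PiNat.self_mem_cylinder w n)
  exact ⟨p, fun i hi => by rw [← hu i hi]; exact wordShift_iterate p t i⟩

theorem exists_eq_of_mem_factors {t w : ℕ → Fin m} {a : Fin m} {n : ℕ}
    (h : a :: wordPrefix w n ∈ factors (inducedSubshift t)) :
    ∃ p, t p = a ∧ ∀ i < n, t (p + 1 + i) = w i := by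
  obtain ⟨u, hu, j, l, hl⟩ := h
  have hv : wordShift^[j] u ∈ inducedSubshift t :=
    (isSubshift_inducedSubshift t).2.iterate j hu
  set v := wordShift^[j] u
  obtain rfl : l = n + 1 := by simpa [wordPrefix] using (congrArg List.length hl).symm
  rw [wordPrefix_succ] at hl
  obtain ⟨h1, h2⟩ := List.cons.inj hl
  obtain ⟨p, hp⟩ := exists_iterate_mem_cylinder hv (n + 1)
  refine ⟨p, ?_, fun i hi => ?_⟩
  · rw [h1, hp 0 n.succ_pos, zero_add]
  · rw [wordPrefix_eq_iff.1 h2 i hi, wordShift, hp (i + 1) (by omega)]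
    congr 1
    ring

/-- A word all of whose prefixes recur with bounded gaps induces a minimal subshift. -/
theorem isMinimalSubshift_inducedSubshift {t : ℕ → Fin m}
    (ht : ∀ n, ∃ N, ∀ p, ∃ q < N, ∀ i < n, t (i + (q + p)) = t i) :
    IsMinimalSubshift (inducedSubshift t) := by
  refine ⟨isSubshift_inducedSubshift t, ⟨t, subset_closure ⟨0, rfl⟩⟩, fun K hK hKs hKne => ?_⟩
  refine Subset.antisymm hK (closure_minimal ?_ hKs.1)
  obtain ⟨k, hk⟩ := hKne
  have hiter : ∀ {v}, v ∈ K → ∀ p, wordShift^[p] v ∈ K := by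
    intro v hv p
    exact hKs.2.iterate p hv
  have htK : t ∈ K := by
    rw [← hKs.1.closure_eq, mem_closure_iff]
    intro U hU htU
    obtain ⟨n, hn⟩ := exists_cylinder_subset hU htU
    obtain ⟨N, hN⟩ := ht n
    -- The first `n + N` letters of `k` are a window of `t`, long enough to contain a copy of the
    -- prefix of length `n`.
    obtain ⟨p, hp⟩ := exists_iterate_mem_cylinder (hK hk) (n + N)
    obtain ⟨q, hq, hqt⟩ := hN p
    refine ⟨wordShift^[q] k, hn fun i hi => ?_, hiter hk q⟩
    rw [wordShift_iterate, hp _ (by omega), ← hqt i hi, add_assoc]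
  rintro _ ⟨p, rfl⟩
  exact hiter htK p

/-- A minimal subshift induced by a word that is not periodic is aperiodic. -/
theorem isAperiodic_inducedSubshift {t : ℕ → Fin m} (hL : IsMinimalSubshift (inducedSubshift t))
    (ht : ∀ p, 0 < p → ∃ i, t (i + p) ≠ t i) : IsAperiodic (inducedSubshift t) := by
  intro w hw p hp hper
  have hcl : IsClosed {v : ℕ → Fin m | wordShift^[p] v = v} :=
    isClosed_eq (continuous_wordShift.iterate p) continuous_id
  have hK : IsSubshift (inducedSubshift t ∩ {v | wordShift^[p] v = v}) := by
    refine ⟨hL.1.1.inter hcl, fun v hv => ⟨hL.1.2 hv.1, ?_⟩⟩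
    have h1 : wordShift^[p] v = v := hv.2
    change wordShift^[p] (wordShift v) = wordShift v
    rw [← Function.iterate_succ_apply, Function.iterate_succ_apply', h1]
  have hKL := hL.2.2 _ inter_subset_left hK ⟨w, hw, hper⟩
  have htL : t ∈ inducedSubshift t := subset_closure ⟨0, rfl⟩
  rw [← hKL] at htL
  obtain ⟨i, hi⟩ := ht p hp
  have hpt : wordShift^[p] t = t := htL.2
  exact hi (by rw [← wordShift_iterate p t i, hpt])

end Invariant

/-! ### Uniform frequencies from block averages -/

section BlockAverages

theorem sum_range_mul_blocks (f : ℕ → ℝ) (B c : ℕ) :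
    ∑ j ∈ Finset.range (B * c), f j =
      ∑ q ∈ Finset.range c, ∑ j ∈ Finset.range B, f (B * q + j) := by
  induction c with
  | zero => simp
  | succ c ih => rw [Nat.mul_succ, Finset.sum_range_add, ih, Finset.sum_range_succ]

/-- If all aligned blocks of length `B` have average at most `H`, then so has every window, up to
a boundary term. -/
theorem sum_window_le {g : ℕ → ℝ} (hg : ∀ j, 0 ≤ g j) {B : ℕ} (hB : 0 < B) {H : ℝ}
    (hH : ∀ q, ∑ j ∈ Finset.range B, g (B * q + j) ≤ B * H) (p N : ℕ) :
    ∑ j ∈ Finset.range N, g (p + j) ≤ H * (N + 2 * B) := by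
  have hBR : (0 : ℝ) < B := Nat.cast_pos.2 hB
  have hH0 : 0 ≤ H := by
    have := (Finset.sum_nonneg fun j _ => hg (B * 0 + j)).trans (hH 0)
    exact nonneg_of_mul_nonneg_right this hBR
  set a := p / B
  -- Enough aligned blocks to cover the window: one extra for the cut at each end.
  set c := N / B + 2
  have hp : B * a + p % B = p := Nat.div_add_mod p B
  have hlt := Nat.mod_lt p hB
  have hN := Nat.div_add_mod N B
  have hlt' := Nat.mod_lt N hB
  have hc : B * c = B * (N / B) + 2 * B := by simp only [c]; ring
  calc ∑ j ∈ Finset.range N, g (p + j)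
      ≤ ∑ j ∈ Finset.range (p % B), g (B * a + j) +
          ∑ j ∈ Finset.range N, g (B * a + (p % B + j)) := by
        rw [← zero_add (∑ j ∈ Finset.range N, g (p + j))]
        refine add_le_add (Finset.sum_nonneg fun j _ => hg _) (le_of_eq ?_)
        exact Finset.sum_congr rfl fun j _ => by rw [← add_assoc, hp]
    _ = ∑ j ∈ Finset.range (p % B + N), g (B * a + j) :=
        (Finset.sum_range_add (fun j => g (B * a + j)) _ _).symm
    _ ≤ ∑ j ∈ Finset.range (B * c), g (B * a + j) :=
        Finset.sum_le_sum_of_subset_of_nonneg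
          (Finset.range_subset_range.2 (by omega)) fun j _ _ => hg _
    _ = ∑ q ∈ Finset.range c, ∑ j ∈ Finset.range B, g (B * (a + q) + j) := by
        rw [sum_range_mul_blocks]
        simp only [mul_add, add_assoc]
    _ ≤ ∑ q ∈ Finset.range c, B * H := Finset.sum_le_sum fun q _ => hH (a + q)
    _ = H * ((B * c : ℕ) : ℝ) := by
        rw [Finset.sum_const, Finset.card_range, nsmul_eq_mul, Nat.cast_mul]; ring
    _ ≤ H * (N + 2 * B) := by
        refine mul_le_mul_of_nonneg_left ?_ hH0
        exact_mod_cast (by omega : B * c ≤ N + 2 * B)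

theorem le_sum_window {g : ℕ → ℝ} (hg : ∀ j, g j ≤ 1) {B : ℕ} (hB : 0 < B) {l : ℝ}
    (hl : ∀ q, B * l ≤ ∑ j ∈ Finset.range B, g (B * q + j)) (p N : ℕ) :
    l * N - (1 - l) * (2 * B) ≤ ∑ j ∈ Finset.range N, g (p + j) := by
  have := sum_window_le (g := fun j => 1 - g j) (fun j => sub_nonneg.2 (hg j)) hB (H := 1 - l)
    (fun q => by
      rw [Finset.sum_sub_distrib, Finset.sum_const, Finset.card_range, nsmul_eq_mul]
      linarith [hl q]) p N
  rw [Finset.sum_sub_distrib, Finset.sum_const, Finset.card_range, nsmul_eq_mul] at this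
  linarith

/-- Iterated averages over `R` children converge uniformly if among the children of every position
there is one with the value at position `0`. -/
theorem exists_bounds_of_averages {R : ℕ} (hR : 0 < R) {G : ℕ → ℕ → ℝ}
    (h01 : ∀ q, G 0 q ∈ Icc (0 : ℝ) 1)
    (hstep : ∀ i q, R * G (i + 1) q = ∑ s ∈ Finset.range R, G i (R * q + s))
    (hrec : ∀ i q, ∃ s < R, G i (R * q + s) = G i 0) (i : ℕ) :
    ∃ lo hi : ℝ, hi - lo = (1 - 1 / (2 * R)) ^ i ∧ ∀ q, G i q ∈ Icc lo hi := by
  have hRR : (0 : ℝ) < R := Nat.cast_pos.2 hR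
  induction i with
  | zero => exact ⟨0, 1, by simp, h01⟩
  | succ i ih =>
    obtain ⟨lo, hi, hd, hG⟩ := ih
    have hlohi : lo ≤ hi := (hG 0).1.trans (hG 0).2
    -- If `G i 0` is in the upper half, the child sharing its value lifts every average by at least
    -- `(hi - lo) / (2 * R)` above `lo`, so the lower bound moves up; otherwise the upper bound
    -- moves down.
    rcases le_total ((lo + hi) / 2) (G i 0) with h | h
    · refine ⟨lo + (hi - lo) / (2 * R), hi, ?_, fun q => ⟨?_, ?_⟩⟩
      · rw [pow_succ, ← hd]; ring
      · obtain ⟨s, hs, hsG⟩ := hrec i q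
        have h1 : ∑ s ∈ Finset.range R, (G i (R * q + s) - lo) ≥ (hi - lo) / 2 := by
          refine le_trans ?_ (Finset.single_le_sum (f := fun s => G i (R * q + s) - lo)
            (fun s _ => sub_nonneg.2 (hG _).1) (Finset.mem_range.2 hs))
          simp only [hsG]
          linarith
        rw [Finset.sum_sub_distrib, ← hstep, Finset.sum_const, Finset.card_range,
          nsmul_eq_mul] at h1
        refine le_of_mul_le_mul_left ?_ hRR
        have h2 : R * (lo + (hi - lo) / (2 * R)) = R * lo + (hi - lo) / 2 := by field_simp
        rw [h2]
        linarith
      · refine le_of_mul_le_mul_left ?_ hRR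
        rw [hstep]
        calc _ ≤ ∑ s ∈ Finset.range R, hi := Finset.sum_le_sum fun s _ => (hG _).2
          _ = R * hi := by simp
    · refine ⟨lo, hi - (hi - lo) / (2 * R), ?_, fun q => ⟨?_, ?_⟩⟩
      · rw [pow_succ, ← hd]; ring
      · refine le_of_mul_le_mul_left ?_ hRR
        rw [hstep]
        calc (R * lo : ℝ) = ∑ s ∈ Finset.range R, lo := by simp
          _ ≤ _ := Finset.sum_le_sum fun s _ => (hG _).1
      · obtain ⟨s, hs, hsG⟩ := hrec i q
        have h1 : ∑ s ∈ Finset.range R, (hi - G i (R * q + s)) ≥ (hi - lo) / 2 := by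
          refine le_trans ?_ (Finset.single_le_sum (f := fun s => hi - G i (R * q + s))
            (fun s _ => sub_nonneg.2 (hG _).2) (Finset.mem_range.2 hs))
          simp only [hsG]
          linarith
        rw [Finset.sum_sub_distrib, ← hstep, Finset.sum_const, Finset.card_range,
          nsmul_eq_mul] at h1
        refine le_of_mul_le_mul_left ?_ hRR
        have h2 : R * (hi - (hi - lo) / (2 * R)) = R * hi - (hi - lo) / 2 := by field_simp
        rw [h2]
        linarith

theorem le_of_forall_mul_le_add {a b C : ℝ} (h : ∀ N : ℕ, a * N ≤ b * N + C) : a ≤ b := by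
  by_contra! hlt
  obtain ⟨N, hN⟩ := exists_nat_gt (C / (a - b))
  rw [div_lt_iff₀ (sub_pos.2 hlt)] at hN
  linarith [h N]

/-- The measure of a cylinder lies between the bounds of the block averages of its occurrences. -/
theorem IsInvariantProbOn.cylinder_mem_Icc {m : ℕ} {t : ℕ → Fin m} {μ : Measure (ℕ → Fin m)}
    (hμ : IsInvariantProbOn (inducedSubshift t) μ) (x : ℕ → Fin m) (n : ℕ) {B : ℕ} (hB : 0 < B)
    {lo hi : ℝ}
    (hb : ∀ q, ∑ j ∈ Finset.range B,
      (PiNat.cylinder x n).indicator 1 (wordShift^[B * q + j] t) ∈ Icc (B * lo) (B * hi)) :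
    μ.real (PiNat.cylinder x n) ∈ Icc lo hi := by
  have := hμ.prob
  set C := PiNat.cylinder x n
  set g : ℕ → ℝ := fun j => C.indicator 1 (wordShift^[j] t) with hg
  have hCm : MeasurableSet C := (isOpen_cylinder_word x n).measurableSet
  have hg0 : ∀ j, 0 ≤ g j := fun j => indicator_nonneg (fun _ _ => zero_le_one) _
  have hg1 : ∀ j, g j ≤ 1 := fun j => indicator_le_self' (fun _ _ => zero_le_one) _
  have hpre : ∀ j : ℕ, MeasurableSet (wordShift^[j] ⁻¹' C) :=
    fun j => (continuous_wordShift.iterate j).measurable hCm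
  have hind : ∀ j : ℕ, Integrable ((wordShift^[j] ⁻¹' C).indicator (1 : (ℕ → Fin m) → ℝ)) μ :=
    fun j => (integrable_const (1 : ℝ)).indicator (hpre j)
  have hint : ∀ N : ℕ, ∫ v, ∑ j ∈ Finset.range N, (wordShift^[j] ⁻¹' C).indicator (1 : (ℕ → Fin m) → ℝ) v ∂μ =
      μ.real C * N := by
    intro N
    rw [integral_finsetSum _ fun j _ => hind j]
    rw [Finset.sum_congr rfl fun j _ => (integral_indicator_one (hpre j)).trans
      ((hμ.invariant.iterate j).measureReal_preimage hCm.nullMeasurableSet)]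
    rw [Finset.sum_const, Finset.card_range, nsmul_eq_mul, mul_comm]
  have hI : ∀ N : ℕ, Integrable
      (fun v => ∑ j ∈ Finset.range N, (wordShift^[j] ⁻¹' C).indicator (1 : (ℕ → Fin m) → ℝ) v) μ :=
    fun N => integrable_finsetSum _ fun j _ => hind j
  -- A word of `L` agrees with a shift of `t` on `N + n` letters, so its orbit sum is a window sum
  -- of `t`. Integrating the window bounds and letting `N` grow removes the boundary terms.
  have hsum : ∀ N : ℕ, ∀ᵐ v ∂μ, ∃ p,
      ∑ j ∈ Finset.range N, (wordShift^[j] ⁻¹' C).indicator (1 : (ℕ → Fin m) → ℝ) v =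
        ∑ j ∈ Finset.range N, g (p + j) := by
    intro N
    have hL : ∀ᵐ v ∂μ, v ∈ inducedSubshift t := hμ.carried
    filter_upwards [hL] with v hv
    obtain ⟨p, hp⟩ := exists_iterate_mem_cylinder hv (N + n)
    refine ⟨p, Finset.sum_congr rfl fun j hj => ?_⟩
    have hj' := Finset.mem_range.1 hj
    have hiff : wordShift^[j] v ∈ C ↔ wordShift^[p + j] t ∈ C := by
      refine forall₂_congr fun i hi => ?_
      rw [wordShift_iterate, wordShift_iterate, hp _ (by omega)]
      rw [show i + j + p = i + (p + j) by ring]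
    by_cases hvC : wordShift^[j] v ∈ C
    · rw [hg]
      simp only [indicator_of_mem (hiff.1 hvC), indicator_of_mem (show v ∈ wordShift^[j] ⁻¹' C from
        hvC), Pi.one_apply]
    · rw [hg]
      simp only [indicator_of_notMem (fun h => hvC (hiff.2 h)),
        indicator_of_notMem (show v ∉ wordShift^[j] ⁻¹' C from hvC)]
  constructor
  · refine le_of_forall_mul_le_add (C := (1 - lo) * (2 * B)) fun N => ?_
    have h1 : ∫ _, (lo * N - (1 - lo) * (2 * B)) ∂μ ≤ μ.real C * N := by
      rw [← hint N]
      refine integral_mono_ae (integrable_const _) (hI N) ?_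
      filter_upwards [hsum N] with v ⟨p, hp⟩
      rw [hp]
      exact le_sum_window hg1 hB (fun q => (hb q).1) p N
    rw [integral_const, probReal_univ, one_smul] at h1
    linarith
  · refine le_of_forall_mul_le_add (C := hi * (2 * B)) fun N => ?_
    have h1 : μ.real C * N ≤ ∫ _, (hi * (N + 2 * B)) ∂μ := by
      rw [← hint N]
      refine integral_mono_ae (hI N) (integrable_const _) ?_
      filter_upwards [hsum N] with v ⟨p, hp⟩
      rw [hp]
      exact sum_window_le hg0 hB (fun q => (hb q).2) p N
    rw [integral_const, probReal_univ, one_smul] at h1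
    linarith

end BlockAverages

/-! ### The generalized Thue–Morse subshifts -/

section ThueMorse

variable {m : ℕ} [NeZero m]

theorem Fin.ofNat_add_eq (a b : ℕ) : Fin.ofNat m (a + b) = Fin.ofNat m a + Fin.ofNat m b := by
  apply Fin.ext
  simp [Fin.val_add, Nat.add_mod]

theorem thueMorse_zero : thueMorse m 0 = 0 := by
  apply Fin.ext
  simp [thueMorse]

theorem thueMorse_two_mul (i : ℕ) : thueMorse m (2 * i) = thueMorse m i := by
  rcases Nat.eq_zero_or_pos i with rfl | hi
  · rfl
  · have := Nat.digits_add 2 one_lt_two 0 i two_pos (Or.inr hi.ne')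
    rw [zero_add] at this
    simp only [thueMorse, this, List.sum_cons, zero_add]

theorem thueMorse_two_mul_add_one (i : ℕ) :
    thueMorse m (2 * i + 1) = thueMorse m i + Fin.ofNat m 1 := by
  have := Nat.digits_add 2 one_lt_two 1 i one_lt_two (Or.inl one_ne_zero)
  rw [add_comm] at this
  simp only [thueMorse, this, List.sum_cons]
  rw [add_comm, Fin.ofNat_add_eq]

/-- The binary expansion of `2 ^ k * q + r` is that of `q` followed by that of `r`, padded to `k`
digits. -/
theorem thueMorse_pow_mul_add (k q r : ℕ) (hr : r < 2 ^ k) :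
    thueMorse m (2 ^ k * q + r) = thueMorse m q + thueMorse m r := by
  induction k generalizing r with
  | zero =>
    rw [pow_zero, Nat.lt_one_iff] at hr
    rw [hr, pow_zero, one_mul, add_zero, thueMorse_zero, add_zero]
  | succ k ih =>
    rw [pow_succ] at hr
    rcases Nat.even_or_odd' r with ⟨s, rfl | rfl⟩
    · rw [show 2 ^ (k + 1) * q + 2 * s = 2 * (2 ^ k * q + s) by ring, thueMorse_two_mul,
        thueMorse_two_mul, ih s (by omega)]
    · rw [show 2 ^ (k + 1) * q + (2 * s + 1) = 2 * (2 ^ k * q + s) + 1 by ring,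
        thueMorse_two_mul_add_one, thueMorse_two_mul_add_one, ih s (by omega), add_assoc]

theorem exists_thueMorse_eq (a : Fin m) : ∃ r < 2 ^ m, thueMorse m r = a := by
  have key : ∀ k, ∃ r < 2 ^ k, thueMorse m r = Fin.ofNat m k := by
    intro k
    induction k with
    | zero => exact ⟨0, one_pos, by rw [thueMorse_zero]; rfl⟩
    | succ k ih =>
      obtain ⟨r, hr, h⟩ := ih
      -- Appending the digit 1 raises the digit sum by one.
      exact ⟨2 * r + 1, by rw [pow_succ]; omega, by
        rw [thueMorse_two_mul_add_one, h, Fin.ofNat_add_eq]⟩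
  obtain ⟨r, hr, h⟩ := key a
  refine ⟨r, hr.trans_le (Nat.pow_le_pow_right two_pos a.2.le), ?_⟩
  rw [h]
  apply Fin.ext
  simp

theorem exists_thueMorse_pow_mul_add_eq (q : ℕ) (a : Fin m) :
    ∃ r < 2 ^ m, thueMorse m (2 ^ m * q + r) = a := by
  obtain ⟨r, hr, h⟩ := exists_thueMorse_eq (a - thueMorse m q)
  exact ⟨r, hr, by rw [thueMorse_pow_mul_add m q r hr, h, add_sub_cancel]⟩

theorem thueMorse_recurrent (n : ℕ) :
    ∃ N, ∀ p, ∃ q < N, ∀ i < n, thueMorse m (i + (q + p)) = thueMorse m i := by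
  refine ⟨2 * (2 ^ n * 2 ^ m), fun p => ?_⟩
  set D := 2 ^ n * 2 ^ m with hD
  have hDpos : 0 < D := by positivity
  -- After a position `2 ^ n * Q` with letter 0 at `Q`, the prefix of length `2 ^ n > n` recurs.
  -- Such a position is sought in the block of length `D` following the one that contains `p`, hence
  -- the gap bound `2 * D`.
  obtain ⟨r, hr, h⟩ := exists_thueMorse_pow_mul_add_eq (p / D + 1) (0 : Fin m)
  have h1 := Nat.div_add_mod p D
  have h2 := Nat.mod_lt p hDpos
  have hP : 2 ^ n * (2 ^ m * (p / D + 1) + r) = D * (p / D) + D + 2 ^ n * r := by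
    rw [hD]; ring
  have h3 : 2 ^ n * r < D := Nat.mul_lt_mul_of_pos_left hr (by positivity)
  refine ⟨2 ^ n * (2 ^ m * (p / D + 1) + r) - p, by omega, fun i hi => ?_⟩
  rw [show i + (2 ^ n * (2 ^ m * (p / D + 1) + r) - p + p) =
    2 ^ n * (2 ^ m * (p / D + 1) + r) + i by omega,
    thueMorse_pow_mul_add n _ i (hi.trans Nat.lt_two_pow_self), h, zero_add]

/-! ### Parity of positions and left special words -/

theorem Fin.ofNat_one_ne_zero (hm : 2 ≤ m) : Fin.ofNat m 1 ≠ 0 := by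
  intro h
  have := congrArg Fin.val h
  simp [Nat.mod_eq_of_lt hm] at this

/-- Occurrences of a factor of length six in the Thue–Morse word have the same parity. -/
theorem thueMorse_parity (hm : 2 ≤ m) (q q' : ℕ)
    (h : ∀ i < 6, thueMorse m (2 * q + i) = thueMorse m (2 * q' + 1 + i)) : False := by
  set e := Fin.ofNat m 1 with he
  have hne : e ≠ 0 := Fin.ofNat_one_ne_zero hm
  have hs : ∀ i, thueMorse m (2 * i + 1) = thueMorse m (2 * i) + e := fun i => by
    rw [thueMorse_two_mul_add_one, thueMorse_two_mul]
  -- A letter at an odd position is its predecessor plus `e`. Under misaligned occurrences this also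
  -- holds at the even positions of the first, so two such steps lead from `q + j` to `q + j + 1`.
  have step : ∀ j < 2, thueMorse m (q + j + 1) = thueMorse m (q + j) + e + e := by
    intro j hj
    rw [← thueMorse_two_mul (q + j + 1), ← thueMorse_two_mul (q + j), ← hs]
    have h1 := h (2 * j + 2) (by omega)
    have h2 := h (2 * j + 1) (by omega)
    have h3 := hs (q' + 1 + j)
    rw [show 2 * (q + j + 1) = 2 * q + (2 * j + 2) by ring, h1,
      show 2 * (q + j) + 1 = 2 * q + (2 * j + 1) by ring, h2,
      show 2 * q' + 1 + (2 * j + 2) = 2 * (q' + 1 + j) + 1 by ring, h3]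
    congr 2
    ring
  -- From an even position to the next the letter grows by `e`, not `e + e`; one of `q`, `q + 1` is
  -- even.
  obtain ⟨j, hj, r, hr⟩ : ∃ j < 2, ∃ r, q + j = 2 * r := by
    rcases Nat.even_or_odd' q with ⟨r, rfl | rfl⟩
    · exact ⟨0, by omega, r, rfl⟩
    · exact ⟨1, by omega, r + 1, by ring⟩
  have h1 := step j hj
  rw [hr, hs] at h1
  exact hne (left_eq_add.1 h1)

/-- An even period can be halved, and an odd one would match positions of opposite parity. -/
theorem thueMorse_not_periodic (hm : 2 ≤ m) (p : ℕ) (hp : 0 < p) :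
    ∃ i, thueMorse m (i + p) ≠ thueMorse m i := by
  induction p using Nat.strong_induction_on with
  | _ p ih =>
    rcases Nat.even_or_odd' p with ⟨r, rfl | rfl⟩
    · obtain ⟨i, hi⟩ := ih r (by omega) (by omega)
      exact ⟨2 * i, by rwa [← mul_add, thueMorse_two_mul, thueMorse_two_mul]⟩
    · by_contra! h
      refine thueMorse_parity hm 0 r fun i _ => ?_
      rw [mul_zero, zero_add, ← h i, add_comm]

/-- If both `a` and `a'` were even, the first common letter would already force equal letters before
it; mixed parity contradicts `thueMorse_parity`. So both are odd, and the even positions of the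
common block give the same situation at half the scale. The length `6 * 2 ^ k` halves with it and
leaves the six letters needed. -/
theorem two_pow_dvd_of_left_special (hm : 2 ≤ m) (k : ℕ) {a a' : ℕ}
    (hne : thueMorse m a ≠ thueMorse m a')
    (h : ∀ i < 6 * 2 ^ k, thueMorse m (a + 1 + i) = thueMorse m (a' + 1 + i)) :
    2 ^ k ∣ a + 1 := by
  induction k generalizing a a' with
  | zero => simp
  | succ k ih =>
    have hk : 0 < 2 ^ k := by positivity
    have hk' : 2 ^ (k + 1) = 2 * 2 ^ k := pow_succ' 2 k
    rcases Nat.even_or_odd' a with ⟨b, rfl | rfl⟩ <;>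
    rcases Nat.even_or_odd' a' with ⟨b', rfl | rfl⟩
    · refine absurd ?_ hne
      have h0 := h 0 (by omega)
      simp only [add_zero, thueMorse_two_mul_add_one] at h0
      rw [thueMorse_two_mul, thueMorse_two_mul]
      exact add_right_cancel h0
    · refine (thueMorse_parity hm (b' + 1) b fun i hi => ?_).elim
      rw [h i (by omega)]
      congr 1
    · refine (thueMorse_parity hm (b + 1) b' fun i hi => ?_).elim
      rw [← h i (by omega)]
      congr 1
    · have hne' : thueMorse m b ≠ thueMorse m b' := fun he => hne (by
        rw [thueMorse_two_mul_add_one, thueMorse_two_mul_add_one, he])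
      obtain ⟨c, hc⟩ := ih hne' fun i hi => by
        have := h (2 * i) (by omega)
        rwa [show 2 * b + 1 + 1 + 2 * i = 2 * (b + 1 + i) by ring,
          show 2 * b' + 1 + 1 + 2 * i = 2 * (b' + 1 + i) by ring, thueMorse_two_mul,
          thueMorse_two_mul] at this
      exact ⟨c, by rw [hk', mul_assoc, ← hc]; ring⟩

/-- A prefix of length `6 * 2 ^ j` occurs at a multiple `2 ^ j * c`, where its letter number `j < 2
^ j` is the initial letter plus `thueMorse m j`. -/
theorem specialWords_thueMorseShift_subset (hm : 2 ≤ m) :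
    specialWords (thueMorseShift m) ⊆ range fun (a : Fin m) (j : ℕ) => a + thueMorse m j := by
  refine fun w hw => ⟨w 0, funext fun j => ?_⟩
  obtain ⟨-, _, ⟨ha, a, rfl⟩, _, ⟨hb, b, rfl⟩, hab⟩ := hw (6 * 2 ^ j)
  obtain ⟨p, hpa, hp⟩ := exists_eq_of_mem_factors ha
  obtain ⟨q, hqb, hq⟩ := exists_eq_of_mem_factors hb
  have hj : j < 2 ^ j := Nat.lt_two_pow_self
  obtain ⟨c, hc⟩ := two_pow_dvd_of_left_special hm j (a := p) (a' := q)
    (fun h => hab (by rw [← hpa, ← hqb, h])) fun i hi => (hp i hi).trans (hq i hi).symm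
  have h0 := thueMorse_pow_mul_add (m := m) j c 0 (by positivity)
  rw [add_zero, thueMorse_zero, add_zero] at h0
  change w 0 + thueMorse m j = w j
  rw [← hp 0 (by omega), ← hp j (by omega), hc, thueMorse_pow_mul_add j c j hj, h0]

theorem countable_specialWords_thueMorseShift (hm : 2 ≤ m) :
    (specialWords (thueMorseShift m)).Countable :=
  (finite_range _).countable.mono (specialWords_thueMorseShift_subset hm)

theorem isMinimalSubshift_thueMorseShift : IsMinimalSubshift (thueMorseShift m) :=
  isMinimalSubshift_inducedSubshift thueMorse_recurrent

theorem isAperiodic_thueMorseShift (hm : 2 ≤ m) : IsAperiodic (thueMorseShift m) :=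
  isAperiodic_inducedSubshift isMinimalSubshift_thueMorseShift (thueMorse_not_periodic hm)

/-- Blocks of length `2 ^ k` see the same occurrences of a word of length at most `2 ^ k` if the
two letters that determine them and their successors agree. -/
theorem thueMorse_block_congr {k q q' j : ℕ} (h0 : thueMorse m q = thueMorse m q')
    (h1 : thueMorse m (q + 1) = thueMorse m (q' + 1)) (hj : j < 2 ^ k + 2 ^ k) :
    thueMorse m (2 ^ k * q + j) = thueMorse m (2 ^ k * q' + j) := by
  rcases lt_or_ge j (2 ^ k) with h | h
  · rw [thueMorse_pow_mul_add k q j h, thueMorse_pow_mul_add k q' j h, h0]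
  · obtain ⟨r, rfl⟩ := Nat.exists_eq_add_of_le h
    have hr : r < 2 ^ k := by omega
    have := (thueMorse_pow_mul_add (m := m) k (q + 1) r hr).trans
      ((congrArg (· + thueMorse m r) h1).trans (thueMorse_pow_mul_add k (q' + 1) r hr).symm)
    rwa [mul_add, mul_add, mul_one, add_assoc, add_assoc] at this

/-- The block averages of the occurrences of a word in the Thue–Morse word converge uniformly. -/
theorem thueMorse_block_bounds (x : ℕ → Fin m) (n i : ℕ) : ∃ B : ℕ, 0 < B ∧ ∃ lo hi : ℝ,
    hi - lo = (1 - 1 / (2 * ((2 ^ (m + 1) : ℕ) : ℝ))) ^ i ∧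
    ∀ q, ∑ j ∈ Finset.range B, (PiNat.cylinder x n).indicator (1 : (ℕ → Fin m) → ℝ)
      (wordShift^[B * q + j] (thueMorse m)) ∈ Icc (B * lo) (B * hi) := by
  -- Some `2 ^ m * q + r` with `r < 2 ^ m` carries the letter 0; doubling it gives a child `R * q +
  -- 2 * r` with letters 0, 1 at it and its successor, as at positions 0 and 1.
  set R := 2 ^ (m + 1) with hR
  have hRpos : 0 < R := by positivity
  set g : ℕ → ℝ := fun j =>
    (PiNat.cylinder x n).indicator (1 : (ℕ → Fin m) → ℝ) (wordShift^[j] (thueMorse m)) with hg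
  have hg0 : ∀ j, 0 ≤ g j := fun j => indicator_nonneg (fun _ _ => zero_le_one) _
  have hg1 : ∀ j, g j ≤ 1 := fun j => indicator_le_self' (fun _ _ => zero_le_one) _
  have hB : ∀ i, (0 : ℝ) < ((2 ^ n * R ^ i : ℕ) : ℝ) := fun i => by positivity
  set G : ℕ → ℕ → ℝ := fun i q =>
    (∑ j ∈ Finset.range (2 ^ n * R ^ i), g (2 ^ n * R ^ i * q + j)) / (2 ^ n * R ^ i : ℕ)
    with hG
  have h01 : ∀ q, G 0 q ∈ Icc (0 : ℝ) 1 := by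
    intro q
    refine ⟨div_nonneg (Finset.sum_nonneg fun j _ => hg0 _) (hB 0).le, ?_⟩
    rw [hG, div_le_one (hB 0)]
    calc _ ≤ ∑ j ∈ Finset.range (2 ^ n * R ^ 0), (1 : ℝ) := Finset.sum_le_sum fun j _ => hg1 _
      _ = _ := by simp
  have hstep : ∀ i q, R * G (i + 1) q = ∑ s ∈ Finset.range R, G i (R * q + s) := by
    intro i q
    have hRR : (R : ℝ) ≠ 0 := Nat.cast_ne_zero.2 hRpos.ne'
    have h1 : 2 ^ n * R ^ (i + 1) = 2 ^ n * R ^ i * R := by rw [pow_succ]; ring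
    simp only [hG]
    rw [← Finset.sum_div, h1, sum_range_mul_blocks, Nat.cast_mul _ R, mul_div_assoc',
      mul_comm (R : ℝ), mul_div_mul_right _ _ hRR]
    congr 1
    refine Finset.sum_congr rfl fun s _ => Finset.sum_congr rfl fun j _ => ?_
    congr 1
    ring
  have hrec : ∀ i q, ∃ s < R, G i (R * q + s) = G i 0 := by
    intro i q
    obtain ⟨r, hr, h⟩ := exists_thueMorse_pow_mul_add_eq q (0 : Fin m)
    have h2 : R * q + 2 * r = 2 * (2 ^ m * q + r) := by rw [hR, pow_succ]; ring
    refine ⟨2 * r, by rw [hR, pow_succ]; omega, ?_⟩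
    have h3 : thueMorse m (R * q + 2 * r) = thueMorse m 0 := by
      rw [h2, thueMorse_two_mul, h, thueMorse_zero]
    have h4 : thueMorse m (R * q + 2 * r + 1) = thueMorse m (0 + 1) := by
      rw [h2, thueMorse_two_mul_add_one, h, ← thueMorse_zero, ← thueMorse_two_mul_add_one]
    have h5 : 2 ^ n * R ^ i = 2 ^ (n + (m + 1) * i) := by rw [hR, ← pow_mul, ← pow_add]
    simp only [hG]
    congr 1
    refine Finset.sum_congr rfl fun j hj => ?_
    rw [Finset.mem_range] at hj
    -- An occurrence starting in a block reaches at most into the next one, so two consecutive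
    -- letters determine the count.
    have h6 : n ≤ 2 ^ n * R ^ i := Nat.lt_two_pow_self.le.trans
      (Nat.le_mul_of_pos_right _ (by positivity))
    have hiff : wordShift^[2 ^ n * R ^ i * (R * q + 2 * r) + j] (thueMorse m) ∈
        PiNat.cylinder x n ↔
        wordShift^[2 ^ n * R ^ i * 0 + j] (thueMorse m) ∈ PiNat.cylinder x n := by
      refine forall₂_congr fun l hl => ?_
      rw [wordShift_iterate, wordShift_iterate, add_left_comm, add_left_comm l]
      rw [h5] at h6 hj ⊢
      rw [thueMorse_block_congr h3 h4 (by omega)]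
    by_cases hmem : wordShift^[2 ^ n * R ^ i * 0 + j] (thueMorse m) ∈ PiNat.cylinder x n
    · simp only [hg, indicator_of_mem hmem, indicator_of_mem (hiff.2 hmem), Pi.one_apply]
    · simp only [hg, indicator_of_notMem hmem, indicator_of_notMem fun h => hmem (hiff.1 h)]
  obtain ⟨lo, hi, hd, hb⟩ := exists_bounds_of_averages hRpos h01 hstep hrec i
  refine ⟨2 ^ n * R ^ i, by positivity, lo, hi, hd, fun q => ?_⟩
  have h1 := (hb q).1
  have h2 := (hb q).2
  simp only [hG] at h1 h2
  rw [le_div_iff₀ (hB i)] at h1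
  rw [div_le_iff₀ (hB i)] at h2
  exact ⟨(mul_comm _ _).trans_le h1, h2.trans_eq (mul_comm _ _)⟩

theorem eq_of_isInvariantProbOn_thueMorseShift {μ ν : Measure (ℕ → Fin m)}
    (hμ : IsInvariantProbOn (thueMorseShift m) μ) (hν : IsInvariantProbOn (thueMorseShift m) ν) :
    μ = ν := by
  have := hμ.prob
  have := hν.prob
  refine measure_ext_of_cylinder fun x n => ?_
  refine (measureReal_eq_measureReal_iff).1 (sub_eq_zero.1 (abs_eq_zero.1
    (le_antisymm ?_ (abs_nonneg _))))
  have hR : (1 : ℝ) ≤ ((2 ^ (m + 1) : ℕ) : ℝ) := by exact_mod_cast Nat.one_le_two_pow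
  set R := ((2 ^ (m + 1) : ℕ) : ℝ)
  have hR1 : 1 / (2 * R) ≤ 1 := by
    rw [div_le_one (by positivity)]
    linarith
  have hR0 : 0 < 1 / (2 * R) := by positivity
  -- Both measures of the cylinder lie in a common interval whose length tends to 0 with `i`.
  refine ge_of_tendsto' (tendsto_pow_atTop_nhds_zero_of_lt_one
    (sub_nonneg.2 hR1) (by linarith)) fun i => ?_
  obtain ⟨B, hB, lo, hi, hd, hb⟩ := thueMorse_block_bounds x n i
  have h1 := hμ.cylinder_mem_Icc x n hB hb
  have h2 := hν.cylinder_mem_Icc x n hB hb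
  rw [← hd]
  exact abs_sub_le_of_le_of_le h1.1 h1.2 h2.1 h2.2

end ThueMorse

theorem mainTheorem5 (m : ℕ) [NeZero m] (hm : 2 ≤ m) :
    IsMinimalSubshift (thueMorseShift m) ∧ IsAperiodic (thueMorseShift m) ∧
    (∃! μ : Measure (ℕ → Fin m), IsInvariantProbOn (thueMorseShift m) μ) ∧
    ∀ μ : Measure (ℕ → Fin m), IsInvariantProbOn (thueMorseShift m) μ →
      (∀ w, μ {w} = 0) ∧
      (∀ v ∈ factors (thueMorseShift m), 0 < μ (wordCylinder (thueMorseShift m) v)) ∧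
      μ (specialWords (thueMorseShift m)) = 0 ∧
      (∀ x ∈ Icc (0 : ℝ) 1, ∃! w, IsValuationInv (thueMorseShift m) μ x w) ∧
      ∃ T : Ico (0 : ℝ) 1 → Ico (0 : ℝ) 1,
        (∀ x, (T x : ℝ) = shiftOnInterval (thueMorseShift m) μ x) ∧ IsIntervalExchange T := by
  have hmin := isMinimalSubshift_thueMorseShift (m := m)
  have hap := isAperiodic_thueMorseShift hm
  have hsp := countable_specialWords_thueMorseShift hm
  obtain ⟨μ₀, hμ₀⟩ := exists_isInvariantProbOn hmin.1 hmin.2.1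
  refine ⟨hmin, hap, ⟨μ₀, hμ₀, fun ν hν => eq_of_isInvariantProbOn_thueMorseShift hν hμ₀⟩,
    fun μ hμ => ?_⟩
  have h := hmin.isFaithfulOn hap hμ
  refine ⟨h.null_singleton, ?_, ?_, fun x hx => h.existsUnique_isValuationInv hx,
    h.exists_isIntervalExchange hsp⟩
  · rintro _ ⟨w, hw, i, n, rfl⟩
    refine (h.pos_cylinder _ (hmin.1.2.iterate i hw) n).trans_le (measure_mono fun u hu => ?_)
    refine ⟨hu.1, ?_⟩
    rw [show (wordPrefix (wordShift^[i] w) n).length = n by simp [wordPrefix]]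
    exact wordPrefix_eq_iff.2 hu.2
  · rw [← biUnion_of_singleton (specialWords (thueMorseShift m))]
    exact (measure_biUnion_null_iff hsp).2 fun w _ => h.null_singleton w
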